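/- Let $k$ be a field, let $n\ge 2$ and $d\ge 2$ be integers, and suppose that $\operatorname{char} k=0$ or $\operatorname{char} k>n(d-1)$. Let $V$ be a $k$-vector space of dimension $n$, and let $S=\operatorname{Sym} V$ act on $\mathcal D=\operatorname{Sym} V^\vee$ by differentiation: $g\circ F=g(\partial/\partial z_1,\dots,\partial/\partial z_n)F$, for dual bases $x_1,\dots,x_n$ of $V$ and $z_1,\dots,z_n$ of $V^\vee$. Let $\operatorname{Grass}(n,\operatorname{Sym}^d V)_{\operatorname{Res}}$ be the set of the $n$-dimensional subspaces $U=\langle g_1,\dots,g_n\rangle\subset \operatorname{Sym}^d V$ such that $g_1,\dots,g_n$ is a regular sequence in $S$ (equivalently, the resultant of $g_1,\dots,g_n$ is nonzero). For such a $U$, let $I_U\subset S$ be the ideal generated by $U$. There is a form $\mathbf A(U)\in\operatorname{Sym}^{n(d-1)}V^\vee$, unique up to a nonzero scalar, with $\{g\in S: g\circ \mathbf A(U)=0\}=I_U$; it is called the associated form of $U$. The subspace $U$ is a balanced direct sum if there are a decomposition $V=W_1\oplus W_2$ with $W_1,W_2\neq 0$ and subspaces $L_i\subset \operatorname{Sym}^d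 W_i$ with $\dim L_i=\dim W_i$ $(i=1,2)$ such that $U=L_1+L_2$. A nonzero form $F\in\mathcal D$ is a balanced direct product if there are a decomposition $V^\vee=W_1\oplus W_2$ with $W_1,W_2\ne 0$ and forms $F_i\in\operatorname{Sym}W_i$ such that $F=F_1F_2$ and $\dim(W_2)\deg F_1=\dim (W_1)\deg F_2$. Then an element $U\in\operatorname{Grass}(n,\operatorname{Sym}^d V)_{\operatorname{Res}}$ is a balanced direct sum if and only if $\mathbf A(U)$ is a balanced direct product. Moreover, let $z_1,\dots,z_n$ be a basis of $V^\vee$ and let $1\le a\le n-1$ be such that $\mathbf A(U)=F_1(z_1,\dots,z_a)\,F_2(z_{a+1},\dots,z_n)$ with $(n-a)\deg F_1=a\deg F_2$, and let $x_1,\dots,x_n$ be the dual basis of $V$. Then $U=L_1+L_2$ with $L_1\subset k[x_1,\dots,x_a]_d$, $\dim L_1=a$, and $L_2\subset k[x_{a+1},\dots,x_n]_d$, $\dim L_2=n-a$. -/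

import Mathlib

open Module

namespace AssocForm

noncomputable section

variable {k V : Type*} [Field k] [AddCommGroup V] [Module k V]

/-- The first order Taylor expansion in the direction `v`: the `k`-algebra homomorphism
`Sym V^∨ → (Sym V^∨)[ε]`, `φ ↦ φ + φ(v) ε` for `φ ∈ V^∨`. -/
def taylor (v : V) :
    SymmetricAlgebra k (Dual k V) →ₐ[k] DualNumber (SymmetricAlgebra k (Dual k V)) :=
  SymmetricAlgebra.lift
    ((TrivSqZeroExt.inlAlgHom k (SymmetricAlgebra k (Dual k V))
        (SymmetricAlgebra k (Dual k V))).toLinearMap ∘ₗ SymmetricAlgebra.ι k (Dual k V) +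
      (TrivSqZeroExt.inrHom (SymmetricAlgebra k (Dual k V))
        (SymmetricAlgebra k (Dual k V))).restrictScalars k ∘ₗ
        Algebra.linearMap k (SymmetricAlgebra k (Dual k V)) ∘ₗ Dual.eval k V v)

/-- The directional derivative `∂_v` on `𝒟 = Sym V^∨` : the coefficient of `ε` in the Taylor
expansion. It is the derivation with `∂_v φ = φ(v)` for `φ ∈ V^∨`
(see `dirDeriv_ι`, `dirDeriv_mul`), so it is `∂/∂z_i` if `v = x_i`
is a member of the basis of `V` dual to `z_1, …, z_n`. -/
def dirDeriv (v : V) : End k (SymmetricAlgebra k (Dual k V)) :=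
  (TrivSqZeroExt.sndHom (SymmetricAlgebra k (Dual k V))
    (SymmetricAlgebra k (Dual k V))).restrictScalars k ∘ₗ (taylor v).toLinearMap

theorem fst_taylor (v : V) (F : SymmetricAlgebra k (Dual k V)) :
    (taylor v F).fst = F := by
  have h : (TrivSqZeroExt.fstHom k (SymmetricAlgebra k (Dual k V))
      (SymmetricAlgebra k (Dual k V))).comp (taylor v) = AlgHom.id k _ := by
    apply SymmetricAlgebra.algHom_ext
    ext φ
    simp [taylor]
  exact congr($h F)

theorem dirDeriv_ι (v : V) (φ : Dual k V) :
    dirDeriv v (SymmetricAlgebra.ι k (Dual k V) φ) = algebraMap k _ (φ v) := by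
  simp [dirDeriv, taylor, Algebra.algebraMap_eq_smul_one]

theorem dirDeriv_algebraMap (v : V) (c : k) :
    dirDeriv v (algebraMap k (SymmetricAlgebra k (Dual k V)) c) = 0 := by
  simp [dirDeriv, TrivSqZeroExt.algebraMap_eq_inl']

theorem dirDeriv_mul (v : V) (F G : SymmetricAlgebra k (Dual k V)) :
    dirDeriv v (F * G) = F * dirDeriv v G + dirDeriv v F * G := by
  simp [dirDeriv, fst_taylor, mul_comm]

theorem dirDeriv_comm (v w : V) :
    dirDeriv (k := k) v * dirDeriv w = dirDeriv w * dirDeriv v := by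
  ext F
  simp only [Module.End.mul_apply]
  induction F using SymmetricAlgebra.induction with
  | algebraMap r => simp [dirDeriv_algebraMap]
  | ι φ => simp [dirDeriv_ι, dirDeriv_algebraMap]
  | mul F G hF hG => simp only [dirDeriv_mul, map_add, hF, hG]; ring
  | add F G hF hG => simp only [map_add, hF, hG]

theorem dirDeriv_add (v w : V) : dirDeriv (k := k) (v + w) = dirDeriv v + dirDeriv w := by
  ext F
  induction F using SymmetricAlgebra.induction with
  | algebraMap r => simp [dirDeriv_algebraMap]
  | ι φ => simp [dirDeriv_ι]
  | mul F G hF hG =>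
    simp only [dirDeriv_mul, LinearMap.add_apply] at hF hG ⊢
    rw [hF, hG]; ring
  | add F G hF hG => simp only [map_add, hF, hG]

theorem dirDeriv_smul (c : k) (v : V) : dirDeriv (c • v) = c • dirDeriv (k := k) v := by
  ext F
  induction F using SymmetricAlgebra.induction with
  | algebraMap r => simp [dirDeriv_algebraMap]
  | ι φ => simp [dirDeriv_ι, Algebra.smul_def]
  | mul F G hF hG =>
    simp only [dirDeriv_mul, LinearMap.smul_apply] at hF hG ⊢
    rw [hF, hG, mul_smul_comm, smul_mul_assoc, smul_add]
  | add F G hF hG => simp only [map_add, hF, hG]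

/-- The polar pairing: the differentiation action of `S = Sym V` on `𝒟 = Sym V^∨`,
`g ∘ F = g(∂/∂z_1, …, ∂/∂z_n) F`, as the `k`-algebra homomorphism `S → End_k 𝒟` that
sends `v ∈ V` to `∂_v`. -/
def polar : SymmetricAlgebra k V →ₐ[k] End k (SymmetricAlgebra k (Dual k V)) :=
  RingCon.liftₐ (TensorAlgebra.symRingCon k V)
    (TensorAlgebra.lift k
      { toFun := fun v : V => dirDeriv (k := k) v
        map_add' := dirDeriv_add
        map_smul' := dirDeriv_smul })
    (by
      refine RingCon.ringConGen_le.2 (fun x y h => ?_)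
      induction h with
      | mul_comm x y =>
        rw [RingCon.ker_apply]
        simp [dirDeriv_comm x y])

theorem polar_ι (v : V) : polar (SymmetricAlgebra.ι k V v) = dirDeriv v := by
  have h : polar (SymmetricAlgebra.ι k V v) = TensorAlgebra.lift k
      { toFun := fun v : V => dirDeriv (k := k) v
        map_add' := dirDeriv_add
        map_smul' := dirDeriv_smul } (TensorAlgebra.ι k v) := rfl
  rw [h]; simp

/-- For a subspace `W` of `M`, the subspace `Sym^d W` of `Sym M`: the span of all the
`d`-fold products of elements of `W`. In particular `symPow ⊤ d` is `Sym^d M`. -/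
def symPow {M : Type*} [AddCommGroup M] [Module k M] (W : Submodule k M) (d : ℕ) :
    Submodule k (SymmetricAlgebra k M) :=
  (W.map (SymmetricAlgebra.ι k M)) ^ d

/-- The (`k`-points of the) locus `Grass(n, Sym^d V)_Res`: the `n`-dimensional subspaces of
`Sym^d V` spanned by a sequence `g_1, …, g_n` that is regular in `Sym V`. -/
def grassRes (k V : Type*) [Field k] [AddCommGroup V] [Module k V] (n d : ℕ) :
    Set (Submodule k (SymmetricAlgebra k V)) :=
  {U | U ≤ symPow ⊤ d ∧ finrank k U = n ∧
    ∃ g : Fin n → SymmetricAlgebra k V, Submodule.span k (Set.range g) = U ∧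
      RingTheory.Sequence.IsRegular (SymmetricAlgebra k V) (List.ofFn g)}

/-- `F` represents the associated form `𝐀(U)`: it is a form of degree `n(d-1)` in `Sym V^∨` whose
apolar ideal `{g | g ∘ F = 0}` is the ideal `I_U` of `Sym V` generated by `U`. -/
def IsAssociatedForm (n d : ℕ) (U : Submodule k (SymmetricAlgebra k V))
    (F : SymmetricAlgebra k (Dual k V)) : Prop :=
  F ∈ symPow (k := k) (⊤ : Submodule k (Dual k V)) (n * (d - 1)) ∧
    ∀ g : SymmetricAlgebra k V,
      g ∈ Ideal.span (U : Set (SymmetricAlgebra k V)) ↔ polar g F = 0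

/-- `L = L₁ + L₂` with `L₁ ⊆ Sym^d W₁`, `L₂ ⊆ Sym^d W₂`, `dim L₁ = dim W₁`, `dim L₂ = dim W₂`.
It is used for complementary subspaces `W₁`, `W₂` of `V`. -/
def IsBalancedSumAlong (d : ℕ) (W₁ W₂ : Submodule k V)
    (L : Submodule k (SymmetricAlgebra k V)) : Prop :=
  ∃ L₁ L₂ : Submodule k (SymmetricAlgebra k V),
    L₁ ≤ symPow W₁ d ∧ L₂ ≤ symPow W₂ d ∧
    finrank k L₁ = finrank k W₁ ∧ finrank k L₂ = finrank k W₂ ∧ L = L₁ ⊔ L₂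

/-- `L ⊆ Sym^d V` is a balanced direct sum. -/
def IsBalancedDirectSum (d : ℕ) (L : Submodule k (SymmetricAlgebra k V)) : Prop :=
  ∃ W₁ W₂ : Submodule k V, IsCompl W₁ W₂ ∧ W₁ ≠ ⊥ ∧ W₂ ≠ ⊥ ∧ IsBalancedSumAlong d W₁ W₂ L

/-- The form `F` is nonzero and `F = F₁ F₂` with forms `F₁ ∈ Sym W₁`, `F₂ ∈ Sym W₂` of degrees
`e₁`, `e₂` such that `dim W₂ · e₁ = dim W₁ · e₂`. It is used for complementary subspaces
`W₁`, `W₂` of `M = V^∨`. (The factors of a nonzero form are forms.) -/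
def IsBalancedProductAlong {M : Type*} [AddCommGroup M] [Module k M] (W₁ W₂ : Submodule k M)
    (F : SymmetricAlgebra k M) : Prop :=
  F ≠ 0 ∧ ∃ (e₁ e₂ : ℕ) (F₁ F₂ : SymmetricAlgebra k M),
    F₁ ∈ symPow W₁ e₁ ∧ F₂ ∈ symPow W₂ e₂ ∧ F = F₁ * F₂ ∧
    finrank k W₂ * e₁ = finrank k W₁ * e₂

/-- The form `F ∈ Sym M` is a balanced direct product. -/
def IsBalancedDirectProduct {M : Type*} [AddCommGroup M] [Module k M]
    (F : SymmetricAlgebra k M) : Prop :=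
  ∃ W₁ W₂ : Submodule k M, IsCompl W₁ W₂ ∧ W₁ ≠ ⊥ ∧ W₂ ≠ ⊥ ∧ IsBalancedProductAlong W₁ W₂ F

/-- The span of the first `a` members of a basis. -/
def headSpan {M : Type*} [AddCommGroup M] [Module k M] {n : ℕ} (b : Basis (Fin n) k M) (a : ℕ) :
    Submodule k M :=
  Submodule.span k (b '' {i | (i : ℕ) < a})

/-- The span of all the members of a basis but the first `a`. -/
def tailSpan {M : Type*} [AddCommGroup M] [Module k M] {n : ℕ} (b : Basis (Fin n) k M) (a : ℕ) :
    Submodule k M :=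
  Submodule.span k (b '' {i | a ≤ (i : ℕ)})

end

end AssocForm

/-! Let `N = n(d-1)`. A regular sequence spanning `U` makes `S/I_U` a graded complete intersection
with Hilbert series `(1 + X + ... + X^(d-1))^n`, so `S/I_U` vanishes above degree `N` and is
one-dimensional in degree `N`. Its socle is one-dimensional: `Ext^n(S/m, S)`, computed from the
variables and from the regular sequence, gives `(I_U : m)/I_U ≅ S/m`. A functional on `Sym^N V` with
kernel the degree-`N` part of `I_U` is then the associated form (`exists_polar_eq_zero_iff`). The
characteristic hypothesis makes `1, ..., N` invertible, so that Euler's formula yields nondegeneracy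
of the polar pairing.

If `U = L₁ + L₂`, then `L₁` and `L₂` cut out complete intersections in `Sym W₁` and `Sym W₂`. The
product of their inverse systems has degree `N` and is annihilated by `I_U`, so it is proportional
to `𝐀(U)` (`isBalancedProductAlong_of_isBalancedSumAlong`).

Conversely, let `𝐀(U) = F₁F₂` and split `x ∈ U` into bidegrees along `V = W₁ ⊕ W₂`. Since `(pq) ∘
(F₁F₂) = (p ∘ F₁)(q ∘ F₂)`, contracting `x` with forms on `W₂` yields forms on `W₁` that annihilate
`F₁`, hence elements of `I_U`. As `I_U` is zero below degree `d`, the mixed components of `x`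
vanish, and `U` is the sum of its intersections with `Sym^d W₁` and `Sym^d W₂`. Each summand defines
a quotient of finite length, so it has dimension at least `dim W_i`; the total being `n`, both are
equalities (`isBalancedSumAlong_of_isBalancedProductAlong`).

Regularity passes between generating sequences of the same ideal through the Hilbert series:
`hilb_ofList` characterizes regular sequences as the equality case of a lexicographic inequality. -/

namespace AssocForm

noncomputable section

/-! ### The grading and functoriality of the symmetric algebra. -/

section Grading

variable {k : Type*} [Field k] {M N P : Type*} [AddCommGroup M] [Module k M]
  [AddCommGroup N] [Module k N] [AddCommGroup P] [Module k P]

theorem symPow_zero (W : Submodule k M) : symPow W 0 = 1 := pow_zero _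

theorem symPow_one (W : Submodule k M) : symPow W 1 = W.map (SymmetricAlgebra.ι k M) := pow_one _

theorem symPow_add (W : Submodule k M) (i j : ℕ) :
    symPow W (i + j) = symPow W i * symPow W j := pow_add _ _ _

theorem symPow_succ (W : Submodule k M) (i : ℕ) :
    symPow W (i + 1) = W.map (SymmetricAlgebra.ι k M) * symPow W i := pow_succ' _ _

theorem ι_mem_symPow {W : Submodule k M} {v : M} (hv : v ∈ W) :
    SymmetricAlgebra.ι k M v ∈ symPow W 1 := by
  rw [symPow_one]; exact Submodule.mem_map_of_mem hv

theorem mul_mem_symPow {W : Submodule k M} {i j : ℕ} {f g : SymmetricAlgebra k M}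
    (hf : f ∈ symPow W i) (hg : g ∈ symPow W j) : f * g ∈ symPow W (i + j) := by
  rw [symPow_add]; exact Submodule.mul_mem_mul hf hg

theorem symPow_mono {W W' : Submodule k M} (h : W ≤ W') (i : ℕ) : symPow W i ≤ symPow W' i :=
  pow_le_pow_left' (Submodule.map_mono h) i

theorem algebraMap_mem_symPow (W : Submodule k M) (c : k) :
    algebraMap k (SymmetricAlgebra k M) c ∈ symPow W 0 := by
  rw [symPow_zero]; exact Submodule.algebraMap_mem c

theorem mem_symPow_zero {W : Submodule k M} {f : SymmetricAlgebra k M} (hf : f ∈ symPow W 0) :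
    ∃ c : k, algebraMap k _ c = f := by
  rw [symPow_zero] at hf; simpa [Submodule.mem_one] using hf

/-- Induction on the degree for elements of `Sym^d W`. -/
theorem symPow_induction {W : Submodule k M}
    {motive : (d : ℕ) → (f : SymmetricAlgebra k M) → f ∈ symPow W d → Prop}
    (algebraMap : ∀ c : k, motive 0 (algebraMap k _ c) (algebraMap_mem_symPow W c))
    (add : ∀ d f g hf hg, motive d f hf → motive d g hg → motive d (f + g) (add_mem hf hg))
    (ι_mul : ∀ v (hv : v ∈ W) d f hf, motive d f hf →
      motive (d + 1) (SymmetricAlgebra.ι k M v * f)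
        (by rw [symPow_succ]; exact Submodule.mul_mem_mul (Submodule.mem_map_of_mem hv) hf))
    {d : ℕ} {f : SymmetricAlgebra k M} (hf : f ∈ symPow W d) : motive d f hf := by
  refine Submodule.pow_induction_on_left' (W.map (SymmetricAlgebra.ι k M))
    (C := fun d f hf => motive d f hf) algebraMap (fun x y i hx hy h h' => add i x y hx hy h h')
    ?_ hf
  rintro _ ⟨v, hv, rfl⟩ i x hx h
  exact ι_mul v hv i x hx h

/-- The map `M → ⨁ Sym^i M` with image in degree one. -/
def gradedι : M →ₗ[k] DirectSum ℕ fun i => ↥(symPow (⊤ : Submodule k M) i) :=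
  DirectSum.lof k ℕ (fun i => ↥(symPow (⊤ : Submodule k M) i)) 1 ∘ₗ
    (SymmetricAlgebra.ι k M).codRestrict _ fun _ => ι_mem_symPow trivial

theorem gradedι_apply (m : M) :
    gradedι (k := k) m = DirectSum.of (fun i => ↥(symPow (⊤ : Submodule k M) i)) 1
      ⟨SymmetricAlgebra.ι k M m, ι_mem_symPow trivial⟩ := rfl

instance gradedMonoid_symPow : SetLike.GradedMonoid fun i => symPow (⊤ : Submodule k M) i where
  one_mem := by rw [symPow_zero]; exact Submodule.one_le.1 le_rfl
  mul_mem _ _ _ _ := mul_mem_symPow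

/-- The symmetric algebra is graded by the subspaces `Sym^i M`. -/
instance gradedAlgebra_symPow : GradedAlgebra fun i => symPow (⊤ : Submodule k M) i :=
  GradedAlgebra.ofAlgHom _ (SymmetricAlgebra.lift gradedι)
    (by
      apply SymmetricAlgebra.algHom_ext
      ext m
      change DirectSum.coeAlgHom _ (SymmetricAlgebra.lift gradedι (SymmetricAlgebra.ι k M m)) = _
      rw [SymmetricAlgebra.lift_ι_apply, gradedι_apply, DirectSum.coeAlgHom_of]
      rfl)
    fun i x => by
      obtain ⟨x, hx⟩ := x
      dsimp only [DirectSum.lof_eq_of]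
      induction hx using symPow_induction with
      | algebraMap r => rw [AlgHom.commutes, DirectSum.algebraMap_apply]; rfl
      | add i x y hx hy ihx ihy => rw [map_add, ihx, ihy, ← map_add]; rfl
      | ι_mul v hv i x hx ih =>
        rw [map_mul, ih, SymmetricAlgebra.lift_ι_apply, gradedι_apply, DirectSum.of_mul_of]
        exact DirectSum.of_eq_of_gradedMonoid_eq (Sigma.subtype_ext (add_comm _ _) rfl)

instance finite_symPow [FiniteDimensional k M] (W : Submodule k M) (i : ℕ) :
    FiniteDimensional k (symPow W i) :=
  Module.Finite.iff_fg.2 (((IsNoetherian.noetherian W).map _).pow i)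

theorem finrank_symPow_zero (W : Submodule k M) : finrank k (symPow W 0) = 1 := by
  rw [symPow_zero, Submodule.one_eq_span]
  exact finrank_span_singleton one_ne_zero

/-- The map of symmetric algebras induced by a linear map. -/
def symMap (T : M →ₗ[k] N) : SymmetricAlgebra k M →ₐ[k] SymmetricAlgebra k N :=
  SymmetricAlgebra.lift (SymmetricAlgebra.ι k N ∘ₗ T)

@[simp]
theorem symMap_ι (T : M →ₗ[k] N) (v : M) :
    symMap T (SymmetricAlgebra.ι k M v) = SymmetricAlgebra.ι k N (T v) := by
  simp [symMap]

theorem symMap_id (f : SymmetricAlgebra k M) : symMap LinearMap.id f = f := by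
  have h : symMap (LinearMap.id : M →ₗ[k] M) = AlgHom.id k _ := by
    apply SymmetricAlgebra.algHom_ext; ext; simp
  simp [h]

theorem symMap_symMap (T : M →ₗ[k] N) (T' : N →ₗ[k] P) (f : SymmetricAlgebra k M) :
    symMap T' (symMap T f) = symMap (T' ∘ₗ T) f := by
  have h : (symMap T').comp (symMap T) = symMap (T' ∘ₗ T) := by
    apply SymmetricAlgebra.algHom_ext; ext; simp
  rw [← h]; rfl

theorem map_symMap_symPow (T : M →ₗ[k] N) (W : Submodule k M) (i : ℕ) :
    (symPow W i).map (symMap T).toLinearMap = symPow (W.map T) i := by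
  rw [symPow, symPow, Submodule.map_pow, ← Submodule.map_comp, ← Submodule.map_comp]
  congr 2
  ext; simp

theorem symMap_mem_symPow (T : M →ₗ[k] N) {W : Submodule k M} {W' : Submodule k N}
    (h : W.map T ≤ W') {i : ℕ} {f : SymmetricAlgebra k M} (hf : f ∈ symPow W i) :
    symMap T f ∈ symPow W' i :=
  symPow_mono h i (map_symMap_symPow T W i ▸ Submodule.mem_map_of_mem hf)

theorem symMap_injective_of_leftInverse {T : M →ₗ[k] N} {T' : N →ₗ[k] M}
    (h : T' ∘ₗ T = LinearMap.id) : Function.Injective (symMap T) :=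
  Function.LeftInverse.injective (g := symMap T') fun f => by rw [symMap_symMap, h, symMap_id]

/-- `Sym^i` of a linear map that agrees with the identity on `W` is the identity on `Sym^i W`. -/
theorem symMap_eq_self {T : M →ₗ[k] M} {W : Submodule k M} (h : ∀ v ∈ W, T v = v) {i : ℕ}
    {f : SymmetricAlgebra k M} (hf : f ∈ symPow W i) : symMap T f = f := by
  induction hf using symPow_induction with
  | algebraMap c => simp
  | add d f g hf hg ihf ihg => rw [map_add, ihf, ihg]
  | ι_mul v hv d f hf ih => rw [map_mul, ih, symMap_ι, h v hv]

/-- A linear map that vanishes on `W` kills `Sym^i W` for `i > 0`. -/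
theorem symMap_eq_zero {T : M →ₗ[k] N} {W : Submodule k M} (h : ∀ v ∈ W, T v = 0) {i : ℕ}
    (hi : i ≠ 0) {f : SymmetricAlgebra k M} (hf : f ∈ symPow W i) : symMap T f = 0 := by
  induction hf using symPow_induction with
  | algebraMap c => simp at hi
  | add d f g hf hg ihf ihg => rw [map_add, ihf hi, ihg hi, add_zero]
  | ι_mul v hv d f hf ih => rw [map_mul, symMap_ι, h v hv, map_zero, zero_mul]

/-- Used for `V ≃ V^∨`, to turn injectivity of the polar pairing into surjectivity. -/
theorem finrank_symPow_top_eq (e : M ≃ₗ[k] N) (i : ℕ) :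
    finrank k (symPow (⊤ : Submodule k M) i) = finrank k (symPow (⊤ : Submodule k N) i) := by
  have h : (symPow (⊤ : Submodule k M) i).map (symMap (e : M →ₗ[k] N)).toLinearMap =
      symPow ⊤ i := by
    rw [map_symMap_symPow, Submodule.map_top, LinearEquiv.range]
  rw [← h]
  refine (Submodule.equivMapOfInjective _ ?_ _).finrank_eq
  exact symMap_injective_of_leftInverse (T' := (e.symm : N →ₗ[k] M)) (by ext; simp)

end Grading

/-! ### Ext and regular sequences: the socle is cyclic. -/

section Ext

universe u

open CategoryTheory Abelian RingTheory.Sequence Limits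

variable {R : Type u} [CommRing R]

/-- Rees' argument: the first element `a` acts on `Ext^(i+1)(N, M)` as zero, since it annihilates
`N`, and injectively, since `Ext^i(N, M/aM) = 0` by induction. -/
theorem subsingleton_ext_of_isWeaklyRegular (N : ModuleCat.{u} R) (rs : List R)
    (hN : ∀ r ∈ rs, r ∈ Module.annihilator R N) (M : ModuleCat.{u} R)
    (hM : IsWeaklyRegular M rs) (i : ℕ) (hi : i < rs.length) : Subsingleton (Ext N M i) := by
  induction rs generalizing M i with
  | nil => simp at hi
  | cons a rs ih =>
    rw [isWeaklyRegular_cons_iff] at hM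
    simp only [List.mem_cons, forall_eq_or_imp] at hN
    cases i with
    | zero =>
      have : Subsingleton (N →ₗ[R] M) := by
        refine ⟨fun f g => LinearMap.ext fun x => ?_⟩
        apply hM.1
        simp only [← map_smul, (Module.mem_annihilator.1 hN.1) x, map_zero]
      exact (Ext.addEquiv₀.trans ModuleCat.homAddEquiv).subsingleton
    | succ i =>
      let g := (AddCommGrpCat.ofHom ((Ext.mk₀ (ModuleCat.smulShortComplex M a).f).postcomp N
          (add_zero (i + 1))))
      have mono_g : Mono g := by
        apply (Ext.covariant_sequence_exact₁' N hM.1.smulShortComplex_shortExact i (i + 1)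
          rfl).mono_g ((AddCommGrpCat.isZero_of_iff_subsingleton.mpr ?_).eq_zero_of_src _)
        exact ih hN.2 (ModuleCat.of R (QuotSMulTop a M)) hM.2 i (by simpa using hi)
      have zero_g : g = 0 := Ext.postcomp_smul_id_eq_zero_of_mem_annihilator hN.1 (i + 1)
      exact AddCommGrpCat.subsingleton_of_isZero (IsZero.of_mono_eq_zero _ zero_g)

/-- Dimension shifting: the connecting map from `Ext(N, M/aM)` is injective because the preceding
`Ext(N, M)` vanishes, and surjective because `a` acts as zero on the next one. -/
theorem ext_linearEquiv_of_isWeaklyRegular (N : ModuleCat.{u} R) (rs : List R)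
    (hN : ∀ r ∈ rs, r ∈ Module.annihilator R N) (M : ModuleCat.{u} R)
    (hM : IsWeaklyRegular M rs) :
    Nonempty (Ext N M rs.length ≃ₗ[R]
      (N →ₗ[R] (M ⧸ (Ideal.ofList rs • ⊤ : Submodule R M)))) := by
  induction rs generalizing M with
  | nil =>
    have e : (M ⧸ (Ideal.ofList ([] : List R) • ⊤ : Submodule R M)) ≃ₗ[R] M :=
      Submodule.quotEquivOfEqBot _ (by simp)
    exact ⟨Ext.linearEquiv₀ ≪≫ₗ ModuleCat.homLinearEquiv ≪≫ₗ LinearEquiv.congrRight e.symm⟩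
  | cons a rs ih =>
    have hM' := hM
    rw [isWeaklyRegular_cons_iff] at hM
    have hN' := hN
    simp only [List.mem_cons, forall_eq_or_imp] at hN
    obtain ⟨e⟩ := ih hN.2 (ModuleCat.of R (QuotSMulTop a M)) hM.2
    have hS := hM.1.smulShortComplex_shortExact
    let δ : Ext N (ModuleCat.of R (QuotSMulTop a M)) rs.length →ₗ[R] Ext N M (rs.length + 1) :=
      { toFun := fun x => x.comp hS.extClass rfl
        map_add' := fun x y => Ext.add_comp _ _ _ _
        map_smul' := fun r x => Ext.smul_comp _ _ _ _ }
    have hδ : Function.Bijective δ := by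
      constructor
      · rw [← LinearMap.ker_eq_bot, LinearMap.ker_eq_bot']
        intro x hx
        obtain ⟨y, rfl⟩ := Ext.covariant_sequence_exact₃ N hS x rfl hx
        have : Subsingleton (Ext N M rs.length) :=
          subsingleton_ext_of_isWeaklyRegular N _ hN' M hM' _ (by simp)
        have hy : y = 0 := Subsingleton.elim (α := Ext N M rs.length) _ _
        rw [hy, Ext.zero_comp]; rfl
      · intro x
        refine Ext.covariant_sequence_exact₁ N hS x ?_ rfl
        have := Ext.postcomp_smul_id_eq_zero_of_mem_annihilator (M := M) hN.1 (rs.length + 1)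
        exact congr($this x)
    exact ⟨(LinearEquiv.ofBijective δ hδ).symm ≪≫ₗ e ≪≫ₗ
      LinearEquiv.congrRight (Submodule.quotOfListConsSMulTopEquivQuotSMulTopInner M a rs).symm⟩

/-- If an ideal is generated by a weakly regular sequence of length `n`, and `I` is generated
by another such sequence that is contained in `m`, then `(I : m) / I` is a cyclic module. -/
theorem exists_socle_generator (rs xs : List R) (hrs : IsWeaklyRegular R rs)
    (hxs : IsWeaklyRegular R xs) (hlen : rs.length = xs.length)
    (hle : ∀ r ∈ rs, r ∈ Ideal.ofList xs) :
    ∃ u₀ : R, (∀ x ∈ Ideal.ofList xs, x * u₀ ∈ Ideal.ofList rs) ∧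
      ∀ u : R, (∀ x ∈ Ideal.ofList xs, x * u ∈ Ideal.ofList rs) →
      ∃ c : R, u - c * u₀ ∈ Ideal.ofList rs := by
  set m := Ideal.ofList xs with hm
  set I := Ideal.ofList rs with hI
  let N : ModuleCat.{u} R := ModuleCat.of R (R ⧸ m)
  have hann : Module.annihilator R N = m := Ideal.annihilator_quotient
  have hx : ∀ r ∈ xs, r ∈ Module.annihilator R N := by
    intro r hr; rw [hann]; exact Ideal.subset_span hr
  have hr : ∀ r ∈ rs, r ∈ Module.annihilator R N := by
    intro r hr; rw [hann]; exact hle r hr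
  obtain ⟨e₁⟩ := ext_linearEquiv_of_isWeaklyRegular N rs hr (ModuleCat.of R R) hrs
  obtain ⟨e₂⟩ := ext_linearEquiv_of_isWeaklyRegular N xs hx (ModuleCat.of R R) hxs
  rw [hlen] at e₁
  have h₁ : (Ideal.ofList rs • ⊤ : Submodule R R) = I := by simp [hI]
  have h₂ : (Ideal.ofList xs • ⊤ : Submodule R R) = m := by simp [hm]
  -- Both sides are `Ext` of `R/m` by `R` in the common length of the two sequences. The left side
  -- is generated by the identity, so the right side, which is `(I : m)/I`, is cyclic.
  let E : ((R ⧸ m) →ₗ[R] (R ⧸ m)) ≃ₗ[R] ((R ⧸ m) →ₗ[R] (R ⧸ I)) :=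
    LinearEquiv.congrRight (Submodule.quotEquivOfEq _ _ h₂).symm ≪≫ₗ e₂.symm ≪≫ₗ e₁ ≪≫ₗ
      LinearEquiv.congrRight (Submodule.quotEquivOfEq _ _ h₁)
  have hE : ∀ f : (R ⧸ m) →ₗ[R] (R ⧸ I), ∃ c : R, f = c • E LinearMap.id := by
    intro f
    obtain ⟨c, hc⟩ := Submodule.Quotient.mk_surjective _ (E.symm f (Submodule.Quotient.mk 1))
    refine ⟨c, ?_⟩
    rw [← map_smul, ← E.symm_apply_eq]
    refine Submodule.linearMap_qext _ (LinearMap.ext_ring ?_)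
    change E.symm f (Submodule.Quotient.mk 1) = c • Submodule.Quotient.mk 1
    rw [← hc, ← Submodule.Quotient.mk_smul, smul_eq_mul, mul_one]
  obtain ⟨u₀, hu₀⟩ := Submodule.Quotient.mk_surjective _
    (E LinearMap.id (Submodule.Quotient.mk 1))
  refine ⟨u₀, fun x hx => ?_, fun u hu => ?_⟩
  · rw [← smul_eq_mul, ← Submodule.Quotient.mk_eq_zero, Submodule.Quotient.mk_smul, hu₀,
      ← map_smul, ← Submodule.Quotient.mk_smul, smul_eq_mul, mul_one,
      (Submodule.Quotient.mk_eq_zero m).2 hx, map_zero]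
  obtain ⟨c, hc⟩ := hE (Submodule.liftQ m (LinearMap.toSpanSingleton R (R ⧸ I)
    (Submodule.Quotient.mk u)) (by
      intro x hx
      rw [LinearMap.mem_ker, LinearMap.toSpanSingleton_apply, ← Submodule.Quotient.mk_smul,
        Submodule.Quotient.mk_eq_zero]
      exact hu x hx))
  refine ⟨c, ?_⟩
  have := congr($hc (Submodule.Quotient.mk 1))
  rw [Submodule.liftQ_apply, LinearMap.toSpanSingleton_apply, one_smul, LinearMap.smul_apply,
    ← hu₀, ← Submodule.Quotient.mk_smul] at this
  exact (Submodule.Quotient.eq _).1 this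

end Ext

/-! ### The lexicographic order on integer power series. -/

section LexNonneg

/-- A power series vanishes or its first nonzero coefficient is positive. -/
def LexNonneg (p : PowerSeries ℤ) : Prop :=
  ∀ j, (∀ i < j, PowerSeries.coeff i p = 0) → 0 ≤ PowerSeries.coeff j p

theorem LexNonneg.zero : LexNonneg 0 := fun j _ => by simp

/-- Leading terms cannot cancel: once all lower coefficients vanish, the two coefficients at `i` are
nonnegative with sum zero. -/
theorem LexNonneg.coeff_eq_zero_of_add {p q : PowerSeries ℤ} (hp : LexNonneg p)
    (hq : LexNonneg q) (j : ℕ) (h : ∀ i < j, PowerSeries.coeff i (p + q) = 0) :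
    ∀ i < j, PowerSeries.coeff i p = 0 ∧ PowerSeries.coeff i q = 0 := by
  intro i
  induction i using Nat.strong_induction_on with
  | _ i ih =>
    intro hi
    have h1 := hp i fun l hl => (ih l hl (hl.trans hi)).1
    have h2 := hq i fun l hl => (ih l hl (hl.trans hi)).2
    have h3 := h i hi
    rw [map_add] at h3
    constructor <;> linarith

theorem LexNonneg.add {p q : PowerSeries ℤ} (hp : LexNonneg p) (hq : LexNonneg q) :
    LexNonneg (p + q) := by
  intro j h
  have := hp.coeff_eq_zero_of_add hq j h
  rw [map_add]
  exact add_nonneg (hp j fun i hi => (this i hi).1) (hq j fun i hi => (this i hi).2)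

theorem LexNonneg.eq_zero_of_add {p q : PowerSeries ℤ} (hp : LexNonneg p) (hq : LexNonneg q)
    (h : p + q = 0) : p = 0 ∧ q = 0 := by
  have (j : ℕ) := hp.coeff_eq_zero_of_add hq (j + 1) (by simp [h]) j (by simp)
  exact ⟨PowerSeries.ext fun j => by simp [(this j).1],
    PowerSeries.ext fun j => by simp [(this j).2]⟩

theorem LexNonneg.of_coeff_nonneg {p : PowerSeries ℤ} (h : ∀ i, 0 ≤ PowerSeries.coeff i p) :
    LexNonneg p := fun j _ => h j

/-- The factor `1 - X^d` does not change the leading term. Coefficientwise nonnegativity would not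
survive it, hence the lexicographic order. -/
theorem LexNonneg.one_sub_X_pow_mul {p : PowerSeries ℤ} (hp : LexNonneg p) {d : ℕ} (hd : d ≠ 0) :
    LexNonneg ((1 - PowerSeries.X ^ d) * p) := by
  have key (i : ℕ) : PowerSeries.coeff i ((1 - PowerSeries.X ^ d) * p) =
      PowerSeries.coeff i p - if d ≤ i then PowerSeries.coeff (i - d) p else 0 := by
    rw [sub_mul, one_mul, map_sub, PowerSeries.coeff_X_pow_mul']
  intro j h
  have h' : ∀ i < j, PowerSeries.coeff i p = 0 := by
    intro i
    induction i using Nat.strong_induction_on with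
    | _ i ih =>
      intro hi
      have := h i hi
      rw [key] at this
      split_ifs at this with hdi
      · rw [ih (i - d) (by omega) (by omega)] at this; simpa using this
      · simpa using this
  rw [key]
  split_ifs with hdj
  · rw [h' (j - d) (by omega), sub_zero]; exact hp j h'
  · rw [sub_zero]; exact hp j h'

end LexNonneg

/-! ### Hilbert series and the numerical criterion for regularity. -/

section Hilbert

variable {k R : Type*} [Field k] [CommRing R] [Algebra k R] (𝒜 : ℕ → Submodule k R)

/-- The ideal quotient `J : g`. -/
def colonIdeal (J : Ideal R) (g : R) : Ideal R :=
  Submodule.comap (LinearMap.toSpanSingleton R R g) J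

theorem mem_colonIdeal {J : Ideal R} {g u : R} : u ∈ colonIdeal J g ↔ u * g ∈ J := Iff.rfl

/-- The Hilbert series of `R / J`, for a homogeneous ideal `J` of the graded ring `R = ⨁ 𝒜 i`. -/
def hilb (J : Ideal R) : PowerSeries ℤ :=
  PowerSeries.mk fun j =>
    (finrank k (𝒜 j) : ℤ) - finrank k ↥(𝒜 j ⊓ J.restrictScalars k)

theorem finrank_map_add_finrank_inf_ker {E F : Type*} [AddCommGroup E] [Module k E]
    [AddCommGroup F] [Module k F] (f : E →ₗ[k] F) (A : Submodule k E) [FiniteDimensional k A] :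
    finrank k (A.map f) + finrank k ↥(A ⊓ LinearMap.ker f) = finrank k A := by
  rw [← LinearMap.finrank_range_add_finrank_ker (f.domRestrict A), LinearMap.range_domRestrict,
    LinearMap.ker_domRestrict, ← Submodule.finrank_map_subtype_eq, Submodule.map_comap_subtype]

theorem isWeaklyRegular_concat_iff {rs : List R} {g : R} :
    RingTheory.Sequence.IsWeaklyRegular R (rs ++ [g]) ↔
      RingTheory.Sequence.IsWeaklyRegular R rs ∧ colonIdeal (Ideal.ofList rs) g =
        Ideal.ofList rs := by
  rw [RingTheory.Sequence.isWeaklyRegular_append_iff,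
    RingTheory.Sequence.isWeaklyRegular_singleton_iff]
  refine and_congr_right fun _ => ?_
  rw [isSMulRegular_iff_right_eq_zero_of_smul, (Submodule.Quotient.mk_surjective _).forall]
  simp only [← Submodule.Quotient.mk_smul, Submodule.Quotient.mk_eq_zero, smul_eq_mul,
    Ideal.mul_top]
  constructor
  · intro h
    refine le_antisymm (fun u hu => h u ?_) fun u hu => ?_
    · rw [mul_comm]; exact hu
    · exact Ideal.mul_mem_right _ _ hu
  · intro h u hu
    rw [← h, mem_colonIdeal, mul_comm]; exact hu

theorem coeff_hilb_mono [∀ i, FiniteDimensional k (𝒜 i)] {J J' : Ideal R} (h : J ≤ J') (j : ℕ) :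
    PowerSeries.coeff j (hilb 𝒜 J') ≤ PowerSeries.coeff j (hilb 𝒜 J) := by
  have := Submodule.finrank_mono (R := k) (inf_le_inf_left (𝒜 j)
    (show J.restrictScalars k ≤ J'.restrictScalars k from h))
  rw [hilb, hilb, PowerSeries.coeff_mk, PowerSeries.coeff_mk]
  omega

variable [GradedAlgebra 𝒜]

theorem isHomogeneous_ofList {rs : List R} {d : ℕ} (hrs : ∀ r ∈ rs, r ∈ 𝒜 d) :
    (Ideal.ofList rs).IsHomogeneous 𝒜 :=
  Ideal.homogeneous_span 𝒜 _ fun x hx => ⟨d, hrs x hx⟩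

theorem isHomogeneous_colonIdeal {J : Ideal R} (hJ : J.IsHomogeneous 𝒜) {d : ℕ} {g : R}
    (hg : g ∈ 𝒜 d) : (colonIdeal J g).IsHomogeneous 𝒜 := by
  intro i u hu
  rw [mem_colonIdeal] at hu ⊢
  rw [← DirectSum.coe_decompose_mul_add_of_right_mem 𝒜 hg]
  exact hJ _ hu

/-- Taking the degree-`j` component of `f = y + u * g` makes the multiplier homogeneous; for `j < d`
that component of `u * g` is zero. -/
theorem mem_of_mem_sup_span_singleton {J : Ideal R} (hJ : J.IsHomogeneous 𝒜) {d : ℕ} {g : R}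
    (hg : g ∈ 𝒜 d) {j : ℕ} {f : R} (hf : f ∈ 𝒜 j) (hfJ : f ∈ J ⊔ Ideal.span {g}) :
    ∃ y ∈ J, ∃ u : R, f = y + u * g ∧ (if d ≤ j then u ∈ 𝒜 (j - d) else u = 0) := by
  obtain ⟨y, hy, z, hz, rfl⟩ := Submodule.mem_sup.1 hfJ
  obtain ⟨u, rfl⟩ := Ideal.mem_span_singleton'.1 hz
  refine ⟨_, hJ j hy, if d ≤ j then DirectSum.decompose 𝒜 u (j - d) else 0, ?_, ?_⟩
  · have h := DirectSum.decompose_of_mem_same 𝒜 hf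
    rw [← h, DirectSum.decompose_add, DirectSum.add_apply, Submodule.coe_add,
      DirectSum.coe_decompose_mul_of_right_mem 𝒜 j hg]
    split_ifs with h
    · simp
    · simp
  · split_ifs with h
    · exact SetLike.coe_mem _
    · rfl

variable [∀ i, FiniteDimensional k (𝒜 i)]

/-- Multiplication by `g` gives the exact sequence `0 → (R/(J : g))(-d) → R/J → R/(J + (g)) → 0`;
dimensions are counted in each degree. -/
theorem hilb_sup_span_singleton {J : Ideal R} (hJ : J.IsHomogeneous 𝒜) {d : ℕ} {g : R}
    (hg : g ∈ 𝒜 d) :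
    hilb 𝒜 (J ⊔ Ideal.span {g}) = hilb 𝒜 J - PowerSeries.X ^ d * hilb 𝒜 (colonIdeal J g) := by
  ext j
  rw [map_sub, PowerSeries.coeff_X_pow_mul', hilb, hilb, hilb, PowerSeries.coeff_mk,
    PowerSeries.coeff_mk, PowerSeries.coeff_mk]
  split_ifs with hdj
  · let π : R →ₗ[k] R ⧸ J := (Ideal.Quotient.mkₐ k J).toLinearMap
    have hπ : LinearMap.ker π = J.restrictScalars k := by
      ext x; simp [π, Ideal.Quotient.eq_zero_iff_mem]
    let μ : R →ₗ[k] R := LinearMap.mulRight k g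
    have h1 := finrank_map_add_finrank_inf_ker π (𝒜 j ⊓ (J ⊔ Ideal.span {g}).restrictScalars k)
    have h2 := finrank_map_add_finrank_inf_ker (π ∘ₗ μ) (𝒜 (j - d))
    have h3 : (𝒜 j ⊓ (J ⊔ Ideal.span {g}).restrictScalars k).map π =
        (𝒜 (j - d)).map (π ∘ₗ μ) := by
      ext x
      simp only [Submodule.mem_map, Submodule.mem_inf, Submodule.restrictScalars_mem]
      constructor
      · rintro ⟨f, ⟨hf, hfJ⟩, rfl⟩
        obtain ⟨y, hy, u, rfl, hu⟩ := mem_of_mem_sup_span_singleton 𝒜 hJ hg hf hfJ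
        rw [if_pos hdj] at hu
        refine ⟨u, hu, ?_⟩
        have : π y = 0 := by
          rw [← LinearMap.mem_ker, hπ]; exact hy
        rw [map_add, this, zero_add]; rfl
      · rintro ⟨u, hu, rfl⟩
        refine ⟨u * g, ⟨?_, ?_⟩, rfl⟩
        · have := SetLike.mul_mem_graded hu hg
          rwa [Nat.sub_add_cancel hdj] at this
        · exact Ideal.mul_mem_left _ _ (Ideal.mem_sup_right (Ideal.mem_span_singleton_self g))
    have h4 : 𝒜 j ⊓ (J ⊔ Ideal.span {g}).restrictScalars k ⊓ LinearMap.ker π =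
        𝒜 j ⊓ J.restrictScalars k := by
      rw [hπ, inf_assoc]
      congr 1
      exact inf_eq_right.2 fun x hx => Ideal.mem_sup_left hx
    have h5 : LinearMap.ker (π ∘ₗ μ) = (colonIdeal J g).restrictScalars k := by
      rw [LinearMap.ker_comp, hπ]; rfl
    rw [h3, h4] at h1
    rw [h5] at h2
    omega
  · have : 𝒜 j ⊓ (J ⊔ Ideal.span {g}).restrictScalars k = 𝒜 j ⊓ J.restrictScalars k := by
      refine le_antisymm (fun f hf => ⟨hf.1, ?_⟩)
        (inf_le_inf_left _ fun x hx => Ideal.mem_sup_left hx)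
      obtain ⟨y, hy, u, rfl, hu⟩ := mem_of_mem_sup_span_singleton 𝒜 hJ hg hf.1 hf.2
      rw [if_neg hdj] at hu
      simpa [hu] using hy
    rw [this, sub_zero]

theorem eq_of_hilb_eq {J J' : Ideal R} (h : J ≤ J') (hJ' : J'.IsHomogeneous 𝒜)
    (he : hilb 𝒜 J = hilb 𝒜 J') : J = J' := by
  refine le_antisymm h fun f hf => ?_
  classical
  rw [← DirectSum.sum_support_decompose 𝒜 f]
  refine Ideal.sum_mem _ fun j _ => ?_
  have h1 : PowerSeries.coeff j (hilb 𝒜 J) = PowerSeries.coeff j (hilb 𝒜 J') := by rw [he]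
  rw [hilb, hilb, PowerSeries.coeff_mk, PowerSeries.coeff_mk] at h1
  have h2 : 𝒜 j ⊓ J.restrictScalars k = 𝒜 j ⊓ J'.restrictScalars k :=
    Submodule.eq_of_le_of_finrank_eq (inf_le_inf_left (𝒜 j)
      (show J.restrictScalars k ≤ J'.restrictScalars k from h)) (by omega)
  have h3 : (DirectSum.decompose 𝒜 f j : R) ∈ 𝒜 j ⊓ J'.restrictScalars k :=
    ⟨SetLike.coe_mem _, hJ' j hf⟩
  rw [← h2] at h3
  exact h3.2

/-- The Hilbert series of the quotient by forms `g₁, …, g_r` of degree `d` is at least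
`(1 - X ^ d) ^ r` times the Hilbert series of the ring, with equality exactly for weakly regular
sequences. -/
theorem hilb_ofList {d : ℕ} (hd : d ≠ 0) (rs : List R) (hrs : ∀ r ∈ rs, r ∈ 𝒜 d) :
    LexNonneg (hilb 𝒜 (Ideal.ofList rs) - (1 - PowerSeries.X ^ d) ^ rs.length * hilb 𝒜 ⊥) ∧
    (hilb 𝒜 (Ideal.ofList rs) = (1 - PowerSeries.X ^ d) ^ rs.length * hilb 𝒜 ⊥ ↔
      RingTheory.Sequence.IsWeaklyRegular R rs) := by
  induction rs using List.reverseRecOn with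
  | nil => simp [LexNonneg.zero]
  | append_singleton rs g ih =>
    simp only [List.mem_append, List.mem_singleton] at hrs
    have hrs' : ∀ r ∈ rs, r ∈ 𝒜 d := fun r hr => hrs r (.inl hr)
    obtain ⟨ih1, ih2⟩ := ih hrs'
    have hg : g ∈ 𝒜 d := hrs g (.inr rfl)
    have hJ := isHomogeneous_ofList 𝒜 hrs'
    rw [isWeaklyRegular_concat_iff, ← ih2, Ideal.ofList_append, Ideal.ofList_singleton,
      hilb_sup_span_singleton 𝒜 hJ hg, List.length_append, List.length_singleton, pow_succ']
    set A := hilb 𝒜 (Ideal.ofList rs)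
    set B := (1 - PowerSeries.X ^ d) ^ rs.length * hilb 𝒜 ⊥
    set K := hilb 𝒜 (colonIdeal (Ideal.ofList rs) g) with hK
    -- The first summand measures the failure of `rs` to be regular, the second the failure of `g`
    -- to be a nonzerodivisor modulo `rs`. Both are lexicographically nonnegative, so the sum
    -- vanishes only if both do.
    have e : A - PowerSeries.X ^ d * K - (1 - PowerSeries.X ^ d) *
        (1 - PowerSeries.X ^ d) ^ rs.length * hilb 𝒜 ⊥ =
        (1 - PowerSeries.X ^ d) * (A - B) + PowerSeries.X ^ d * (A - K) := by
      simp only [B]; ring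
    have hle : Ideal.ofList rs ≤ colonIdeal (Ideal.ofList rs) g :=
      fun u hu => Ideal.mul_mem_right _ _ hu
    have n1 := ih1.one_sub_X_pow_mul hd
    have n2 : LexNonneg (PowerSeries.X ^ d * (A - K)) := by
      refine LexNonneg.of_coeff_nonneg fun i => ?_
      rw [PowerSeries.coeff_X_pow_mul']
      split_ifs with h
      · have := coeff_hilb_mono 𝒜 hle (i - d)
        rw [map_sub]; linarith
      · rfl
    refine ⟨?_, ?_⟩
    · rw [e]; exact n1.add n2
    · rw [← sub_eq_zero, e]
      constructor
      · intro h
        obtain ⟨h1, h2⟩ := n1.eq_zero_of_add n2 h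
        have hX : (PowerSeries.X : PowerSeries ℤ) ^ d ≠ 0 := pow_ne_zero _ PowerSeries.X_ne_zero
        have hX' : (1 - PowerSeries.X ^ d : PowerSeries ℤ) ≠ 0 := by
          intro h0
          have := congrArg PowerSeries.constantCoeff h0
          simp [hd] at this
        refine ⟨sub_eq_zero.1 ((mul_eq_zero.1 h1).resolve_left hX'), ?_⟩
        exact (eq_of_hilb_eq 𝒜 hle (isHomogeneous_colonIdeal 𝒜 hJ hg)
          (sub_eq_zero.1 ((mul_eq_zero.1 h2).resolve_left hX))).symm
      · rintro ⟨h1, h2⟩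
        have : K = A := by rw [hK, h2]
        rw [h1, this, h1]; ring

/-- Two sequences of forms of the same degree and length that generate the same ideal are both
weakly regular or both not. -/
theorem isWeaklyRegular_of_ofList_eq {d : ℕ} (hd : d ≠ 0) {rs rs' : List R}
    (hrs : ∀ r ∈ rs, r ∈ 𝒜 d) (hrs' : ∀ r ∈ rs', r ∈ 𝒜 d) (hlen : rs.length = rs'.length)
    (h : Ideal.ofList rs = Ideal.ofList rs') (hreg : RingTheory.Sequence.IsWeaklyRegular R rs) :
    RingTheory.Sequence.IsWeaklyRegular R rs' := by
  rw [← (hilb_ofList 𝒜 hd rs hrs).2, h, hlen] at hreg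
  exact (hilb_ofList 𝒜 hd rs' hrs').2.1 hreg

end Hilbert

/-! ### Complete intersections in the symmetric algebra: top degree and socle. -/

section CompleteIntersection

open RingTheory.Sequence

theorem isWeaklyRegular_map_X {k σ : Type*} [Field k] {l : List σ} (hl : l.Nodup) :
    IsWeaklyRegular (MvPolynomial σ k) (l.map MvPolynomial.X : List (MvPolynomial σ k)) := by
  induction l using List.reverseRecOn with
  | nil => simp
  | append_singleton l i ih =>
    have hi : i ∉ l := by
      intro h
      exact (List.nodup_append.1 hl).2.2 i h i (by simp) rfl
    rw [List.map_append, List.map_singleton, isWeaklyRegular_concat_iff]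
    refine ⟨ih (List.nodup_append.1 hl).1, ?_⟩
    have hspan : Ideal.ofList (l.map MvPolynomial.X : List (MvPolynomial σ k)) =
        Ideal.span (MvPolynomial.X '' {j | j ∈ l}) := by
      rw [Ideal.ofList]; congr 1; ext; simp
    rw [hspan]
    refine le_antisymm (fun u hu => ?_) fun u hu => Ideal.mul_mem_right _ _ hu
    rw [mem_colonIdeal, MvPolynomial.mem_ideal_span_X_image] at hu
    rw [MvPolynomial.mem_ideal_span_X_image]
    intro m hm
    -- The ideal is monomial, and multiplying a monomial by `X i` does not affect its divisibility
    -- by `X j` for `j ≠ i`.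
    obtain ⟨j, hj, hmj⟩ := hu (m + Finsupp.single i 1) (by
      rw [MvPolynomial.support_mul_X]; simpa using hm)
    refine ⟨j, hj, ?_⟩
    have hij : i ≠ j := fun h => hi (h ▸ hj)
    simpa [Finsupp.single_apply, hij] using hmj

variable {k V : Type*} [Field k] [AddCommGroup V] [Module k V]

/-- The sequence of the variables of `Sym V` with respect to a basis of `V`. -/
def varList {n : ℕ} (b : Basis (Fin n) k V) : List (SymmetricAlgebra k V) :=
  List.ofFn fun i => SymmetricAlgebra.ι k V (b i)

theorem isWeaklyRegular_varList {n : ℕ} (b : Basis (Fin n) k V) :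
    IsWeaklyRegular (SymmetricAlgebra k V) (varList b) := by
  let e := SymmetricAlgebra.equivMvPolynomial b
  rw [AddEquiv.isWeaklyRegular_congr (e := (e : SymmetricAlgebra k V ≃+ MvPolynomial (Fin n) k))
    (bs := ((List.finRange n).map MvPolynomial.X : List (MvPolynomial (Fin n) k)))]
  · exact isWeaklyRegular_map_X (List.nodup_finRange n)
  · rw [varList, List.ofFn_eq_map, List.forall₂_map_left_iff, List.forall₂_map_right_iff,
      List.forall₂_same]
    intro i _ x
    change e (SymmetricAlgebra.ι k V (b i) * x) = MvPolynomial.X i * e x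
    rw [map_mul, SymmetricAlgebra.equivMvPolynomial_ι_apply]

theorem varList_mem {n : ℕ} (b : Basis (Fin n) k V) :
    ∀ r ∈ varList b, r ∈ symPow (⊤ : Submodule k V) 1 := by
  intro r hr
  obtain ⟨i, rfl⟩ := List.mem_ofFn.1 hr
  exact ι_mem_symPow trivial

theorem ι_mem_ofList_varList {n : ℕ} (b : Basis (Fin n) k V) (v : V) :
    SymmetricAlgebra.ι k V v ∈ Ideal.ofList (varList b) := by
  rw [← b.sum_repr v, map_sum]
  refine Ideal.sum_mem _ fun i _ => ?_
  rw [map_smul, Algebra.smul_def]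
  exact Ideal.mul_mem_left _ _ (Ideal.subset_span (List.mem_ofFn.2 ⟨i, rfl⟩))

theorem symPow_le_of_forall_ι_mul_mem {I : Ideal (SymmetricAlgebra k V)} {j : ℕ}
    (h : ∀ v, ∀ f ∈ symPow (⊤ : Submodule k V) j, SymmetricAlgebra.ι k V v * f ∈ I) :
    ∀ f ∈ symPow (⊤ : Submodule k V) (j + 1), f ∈ I := by
  intro f hf
  rw [symPow_succ] at hf
  induction hf using Submodule.mul_induction_on' with
  | mem_mul_mem x hx y hy => obtain ⟨v, -, rfl⟩ := hx; exact h v y hy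
  | add x _ y _ hx hy => exact add_mem hx hy

theorem algebraMapInv_eq_zero {n : ℕ} (b : Basis (Fin n) k V) {f : SymmetricAlgebra k V}
    (hf : f ∈ Ideal.ofList (varList b)) : SymmetricAlgebra.algebraMapInv (R := k) f = 0 := by
  have : Ideal.ofList (varList b) ≤ RingHom.ker
      (SymmetricAlgebra.algebraMapInv (R := k) (M := V)) := by
    rw [Ideal.ofList, Ideal.span_le]
    rintro _ hr
    obtain ⟨i, rfl⟩ := List.mem_ofFn.1 hr
    exact SymmetricAlgebra.algebraMapInv_ι _
  exact this hf

theorem sub_algebraMapInv_mem {n : ℕ} (b : Basis (Fin n) k V) (f : SymmetricAlgebra k V) :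
    f - algebraMap k _ (SymmetricAlgebra.algebraMapInv (R := k) f) ∈ Ideal.ofList (varList b) := by
  induction f using SymmetricAlgebra.induction with
  | algebraMap r =>
    rw [AlgHom.commutes]; simp
  | ι v =>
    rw [SymmetricAlgebra.algebraMapInv_ι, map_zero, sub_zero]
    exact ι_mem_ofList_varList b v
  | mul f g hf hg =>
    have := add_mem (Ideal.mul_mem_right g _ hf) (Ideal.mul_mem_left _
      (algebraMap k _ (SymmetricAlgebra.algebraMapInv (R := k) f)) hg)
    rw [map_mul, map_mul]
    convert this using 1
    ring
  | add f g hf hg =>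
    have := add_mem hf hg
    rw [map_add, map_add]
    convert this using 1
    ring

theorem hilb_ofList_varList {n : ℕ} (b : Basis (Fin n) k V) :
    hilb (fun i => symPow (⊤ : Submodule k V) i) (Ideal.ofList (varList b)) = 1 := by
  ext j
  rw [hilb, PowerSeries.coeff_mk, PowerSeries.coeff_one]
  split_ifs with hj
  · subst hj
    have : symPow (⊤ : Submodule k V) 0 ⊓ (Ideal.ofList (varList b)).restrictScalars k = ⊥ := by
      rw [eq_bot_iff]
      rintro f ⟨h0, hf⟩
      obtain ⟨c, rfl⟩ := mem_symPow_zero h0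
      have := algebraMapInv_eq_zero b hf
      rw [AlgHom.commutes] at this
      simp_all
    rw [this, finrank_symPow_zero]; simp
  · obtain ⟨j, rfl⟩ := Nat.exists_eq_succ_of_ne_zero hj
    have : symPow (⊤ : Submodule k V) (j + 1) ⊓ (Ideal.ofList (varList b)).restrictScalars k =
        symPow ⊤ (j + 1) := by
      refine inf_eq_left.2 (symPow_le_of_forall_ι_mul_mem fun v f _ => ?_)
      exact Ideal.mul_mem_right _ _ (ι_mem_ofList_varList b v)
    rw [Nat.succ_eq_add_one, this, sub_self]

variable [FiniteDimensional k V]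

/-- No monomials are counted: the variables form a regular sequence with quotient `k`, of Hilbert
series `1`. -/
theorem one_sub_X_pow_mul_hilb_bot :
    (1 - PowerSeries.X) ^ finrank k V * hilb (fun i => symPow (⊤ : Submodule k V) i) ⊥ = 1 := by
  have b := finBasis k V
  have h := (hilb_ofList (fun i => symPow (⊤ : Submodule k V) i) one_ne_zero (varList b)
    (varList_mem b)).2.2 (isWeaklyRegular_varList b)
  rw [hilb_ofList_varList, pow_one, varList, List.length_ofFn] at h
  exact h.symm

theorem one_sub_X_pow_mul_hilb {d : ℕ} (hd : d ≠ 0) {rs : List (SymmetricAlgebra k V)}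
    (hrs : ∀ r ∈ rs, r ∈ symPow (⊤ : Submodule k V) d)
    (hreg : IsWeaklyRegular (SymmetricAlgebra k V) rs) :
    (1 - PowerSeries.X) ^ finrank k V *
      hilb (fun i => symPow (⊤ : Submodule k V) i) (Ideal.ofList rs) =
      (1 - PowerSeries.X ^ d) ^ rs.length := by
  rw [(hilb_ofList (fun i => symPow (⊤ : Submodule k V) i) hd rs hrs).2.2 hreg, mul_left_comm,
    one_sub_X_pow_mul_hilb_bot, mul_one]

theorem one_sub_X_ne_zero : (1 - PowerSeries.X : PowerSeries ℤ) ≠ 0 := by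
  intro h0
  have := congrArg PowerSeries.constantCoeff h0
  simp at this

/-- The right side is monic of degree `finrank k V * (d - 1)`; this yields the vanishing of the
quotient above that degree and its nonvanishing in it. -/
theorem hilb_eq_geom_sum_pow {d : ℕ} (hd : d ≠ 0) {rs : List (SymmetricAlgebra k V)}
    (hlen : rs.length = finrank k V) (hrs : ∀ r ∈ rs, r ∈ symPow (⊤ : Submodule k V) d)
    (hreg : IsWeaklyRegular (SymmetricAlgebra k V) rs) :
    hilb (fun i => symPow (⊤ : Submodule k V) i) (Ideal.ofList rs) =
      (((∑ i ∈ Finset.range d, Polynomial.X ^ i) ^ finrank k V : Polynomial ℤ) :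
        PowerSeries ℤ) := by
  refine mul_left_cancel₀ (pow_ne_zero (finrank k V) one_sub_X_ne_zero) ?_
  rw [one_sub_X_pow_mul_hilb hd hrs hreg, hlen, Polynomial.coe_pow, ← mul_pow]
  congr 1
  rw [← mul_neg_geom_sum]
  congr 1
  rw [← Polynomial.coeToPowerSeries.ringHom_apply, map_sum]
  simp

theorem monic_geom_sum {d : ℕ} (hd : d ≠ 0) :
    (∑ i ∈ Finset.range d, Polynomial.X ^ i : Polynomial ℤ).Monic :=
  Polynomial.monic_X.geom_sum (by simp) hd

theorem natDegree_geom_sum {d : ℕ} (hd : d ≠ 0) :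
    (∑ i ∈ Finset.range d, Polynomial.X ^ i : Polynomial ℤ).natDegree = d - 1 := by
  have h := congrArg Polynomial.natDegree (geom_sum_mul (Polynomial.X : Polynomial ℤ) d)
  have h1 : (Polynomial.X - 1 : Polynomial ℤ).Monic := Polynomial.monic_X_sub_C 1
  have h2 : (Polynomial.X - 1 : Polynomial ℤ).natDegree = 1 := Polynomial.natDegree_X_sub_C 1
  rw [(monic_geom_sum hd).natDegree_mul h1, h2,
    show (Polynomial.X ^ d - 1 : Polynomial ℤ) = Polynomial.X ^ d - Polynomial.C 1 by simp,
    Polynomial.natDegree_X_pow_sub_C] at h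
  omega

variable {d : ℕ} {rs : List (SymmetricAlgebra k V)}

theorem symPow_le_ofList (hd : d ≠ 0) (hlen : rs.length = finrank k V)
    (hrs : ∀ r ∈ rs, r ∈ symPow (⊤ : Submodule k V) d)
    (hreg : IsWeaklyRegular (SymmetricAlgebra k V) rs) {j : ℕ} (hj : finrank k V * (d - 1) < j)
    {f : SymmetricAlgebra k V} (hf : f ∈ symPow (⊤ : Submodule k V) j) : f ∈ Ideal.ofList rs := by
  have h := congrArg (PowerSeries.coeff j) (hilb_eq_geom_sum_pow hd hlen hrs hreg)
  rw [Polynomial.coeff_coe, Polynomial.coeff_eq_zero_of_natDegree_lt, hilb,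
    PowerSeries.coeff_mk] at h
  · have h' : symPow (⊤ : Submodule k V) j ⊓ (Ideal.ofList rs).restrictScalars k =
        symPow ⊤ j := Submodule.eq_of_le_of_finrank_eq inf_le_left (by omega)
    rw [← h'] at hf
    exact hf.2
  · rwa [(monic_geom_sum hd).natDegree_pow, natDegree_geom_sum hd]

theorem exists_notMem_ofList (hd : d ≠ 0) (hlen : rs.length = finrank k V)
    (hrs : ∀ r ∈ rs, r ∈ symPow (⊤ : Submodule k V) d)
    (hreg : IsWeaklyRegular (SymmetricAlgebra k V) rs) :
    ∃ w ∈ symPow (⊤ : Submodule k V) (finrank k V * (d - 1)), w ∉ Ideal.ofList rs := by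
  by_contra! hcon
  have h := congrArg (PowerSeries.coeff (finrank k V * (d - 1)))
    (hilb_eq_geom_sum_pow hd hlen hrs hreg)
  have hm := (monic_geom_sum hd).pow (finrank k V)
  have hm' := hm.coeff_natDegree
  rw [(monic_geom_sum hd).natDegree_pow, natDegree_geom_sum hd] at hm'
  have h' : symPow (⊤ : Submodule k V) (finrank k V * (d - 1)) ⊓
      (Ideal.ofList rs).restrictScalars k = symPow ⊤ (finrank k V * (d - 1)) :=
    inf_eq_left.2 hcon
  rw [Polynomial.coeff_coe, hm', hilb, PowerSeries.coeff_mk, h', sub_self] at h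
  exact zero_ne_one h

/-- The socle of a complete intersection is one-dimensional. -/
theorem exists_smul_sub_mem (hd : d ≠ 0) (hlen : rs.length = finrank k V)
    (hrs : ∀ r ∈ rs, r ∈ symPow (⊤ : Submodule k V) d)
    (hreg : IsWeaklyRegular (SymmetricAlgebra k V) rs) {w : SymmetricAlgebra k V}
    (hw : w ∈ symPow (⊤ : Submodule k V) (finrank k V * (d - 1))) (hwI : w ∉ Ideal.ofList rs)
    {u : SymmetricAlgebra k V} (hu : ∀ v, SymmetricAlgebra.ι k V v * u ∈ Ideal.ofList rs) :
    ∃ c : k, u - c • w ∈ Ideal.ofList rs := by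
  set I := Ideal.ofList rs with hI
  have b := finBasis k V
  have hle : ∀ r ∈ rs, r ∈ Ideal.ofList (varList b) := by
    intro r hr
    obtain ⟨d, rfl⟩ := Nat.exists_eq_succ_of_ne_zero hd
    refine symPow_le_of_forall_ι_mul_mem (fun v f _ => ?_) _ (hrs r hr)
    exact Ideal.mul_mem_right _ _ (ι_mem_ofList_varList b v)
  obtain ⟨u₀, hu₀, hgen⟩ := exists_socle_generator rs (varList b) hreg (isWeaklyRegular_varList b)
    (by simpa [varList] using hlen) hle
  have key : ∀ u, (∀ v, SymmetricAlgebra.ι k V v * u ∈ I) → ∃ c : k, u - c • u₀ ∈ I := by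
    intro u hu
    have hu' : ∀ x ∈ Ideal.ofList (varList b), x * u ∈ I := by
      have : Ideal.ofList (varList b) ≤ colonIdeal I u := by
        rw [Ideal.ofList, Ideal.span_le]
        intro r hr
        obtain ⟨i, rfl⟩ := List.mem_ofFn.1 hr
        exact hu _
      exact this
    obtain ⟨c, hc⟩ := hgen u hu'
    -- The multiplier matters only modulo the ideal of the variables, which carries `u₀` into `I`;
    -- so its constant term suffices.
    refine ⟨SymmetricAlgebra.algebraMapInv (R := k) c, ?_⟩
    have hc' := sub_algebraMapInv_mem b c
    have := add_mem hc (hu₀ _ hc')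
    rw [Algebra.smul_def]
    convert this using 1
    ring
  obtain ⟨c, hc⟩ := key u hu
  -- As `w` has top degree, it lies in the socle itself, so it can replace the generator `u₀`.
  obtain ⟨c', hc'⟩ := key w fun v => symPow_le_ofList hd hlen hrs hreg (by omega)
    (mul_mem_symPow (ι_mem_symPow trivial) hw)
  have h0 : c' ≠ 0 := by
    rintro rfl; simp at hc'; exact hwI hc'
  refine ⟨c / c', ?_⟩
  have h2 : u - (c / c') • w = (u - c • u₀) - algebraMap k _ (c / c') * (w - c' • u₀) := by
    rw [← Algebra.smul_def, smul_sub, smul_smul, div_mul_cancel₀ _ h0]; abel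
  rw [h2]
  exact sub_mem hc (Ideal.mul_mem_left _ _ hc')

/-- The socle is concentrated in top degree: modulo `I` the element `u` is a multiple of a form `w`
of that degree, and the degree-`j` component of `u - c • w` is `u`. -/
theorem mem_of_forall_ι_mul_mem (hd : d ≠ 0) (hlen : rs.length = finrank k V)
    (hrs : ∀ r ∈ rs, r ∈ symPow (⊤ : Submodule k V) d)
    (hreg : IsWeaklyRegular (SymmetricAlgebra k V) rs) {j : ℕ} (hj : j ≠ finrank k V * (d - 1))
    {u : SymmetricAlgebra k V} (hu : u ∈ symPow (⊤ : Submodule k V) j)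
    (h : ∀ v, SymmetricAlgebra.ι k V v * u ∈ Ideal.ofList rs) : u ∈ Ideal.ofList rs := by
  obtain ⟨w, hw, hwI⟩ := exists_notMem_ofList hd hlen hrs hreg
  obtain ⟨c, hc⟩ := exists_smul_sub_mem hd hlen hrs hreg hw hwI h
  have := isHomogeneous_ofList (fun i => symPow (⊤ : Submodule k V) i) hrs j hc
  rw [DirectSum.decompose_sub, DirectSum.sub_apply, Submodule.coe_sub,
    DirectSum.decompose_of_mem_same (fun i => symPow (⊤ : Submodule k V) i) hu,
    DirectSum.decompose_of_mem_ne (fun i => symPow (⊤ : Submodule k V) i)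
      (Submodule.smul_mem _ c hw) hj.symm, sub_zero] at this
  exact this

end CompleteIntersection

/-! ### The polar pairing and its nondegeneracy. -/

section Polar

variable {k V : Type*} [Field k] [AddCommGroup V] [Module k V]

theorem polar_mul_apply (g h : SymmetricAlgebra k V) (F : SymmetricAlgebra k (Dual k V)) :
    polar (g * h) F = polar g (polar h F) := by
  rw [map_mul, Module.End.mul_apply]

theorem polar_algebraMap (c : k) (F : SymmetricAlgebra k (Dual k V)) :
    polar (algebraMap k (SymmetricAlgebra k V) c) F = c • F := by
  rw [AlgHom.commutes, Module.algebraMap_end_apply]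

/-- The degree-zero case is carried along because the Leibniz term `φ * ∂_v f` with `f` constant
must be known to vanish. -/
theorem dirDeriv_mem_symPow_aux (v : V) {Z : Submodule k (Dual k V)} {d : ℕ}
    {F : SymmetricAlgebra k (Dual k V)} (hF : F ∈ symPow Z d) :
    (d = 0 → dirDeriv v F = 0) ∧ ∀ j, d = j + 1 → dirDeriv v F ∈ symPow Z j := by
  induction hF using symPow_induction with
  | algebraMap c => exact ⟨fun _ => dirDeriv_algebraMap v c, by simp⟩
  | add d f g hf hg ihf ihg =>
    refine ⟨fun h => ?_, fun j h => ?_⟩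
    · rw [map_add, ihf.1 h, ihg.1 h, add_zero]
    · rw [map_add]; exact add_mem (ihf.2 j h) (ihg.2 j h)
  | ι_mul φ hφ d f hf ih =>
    refine ⟨by simp, fun j h => ?_⟩
    obtain rfl : d = j := by omega
    rw [dirDeriv_mul, dirDeriv_ι, ← Algebra.smul_def]
    refine add_mem ?_ (Submodule.smul_mem _ _ hf)
    cases d with
    | zero => rw [ih.1 rfl, mul_zero]; exact zero_mem _
    | succ d =>
      rw [add_comm]; exact mul_mem_symPow (ι_mem_symPow hφ) (ih.2 d rfl)

theorem dirDeriv_mem_symPow (v : V) {Z : Submodule k (Dual k V)} {d : ℕ}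
    {F : SymmetricAlgebra k (Dual k V)} (hF : F ∈ symPow Z (d + 1)) :
    dirDeriv v F ∈ symPow Z d := (dirDeriv_mem_symPow_aux v hF).2 d rfl

theorem dirDeriv_eq_zero_of_mem_symPow_zero (v : V) {Z : Submodule k (Dual k V)}
    {F : SymmetricAlgebra k (Dual k V)} (hF : F ∈ symPow Z 0) :
    dirDeriv v F = 0 := (dirDeriv_mem_symPow_aux v hF).1 rfl

theorem polar_mem_symPow {W : Submodule k V} {Z : Submodule k (Dual k V)} {i j : ℕ}
    {g : SymmetricAlgebra k V} (hg : g ∈ symPow W i) {F : SymmetricAlgebra k (Dual k V)}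
    (hF : F ∈ symPow Z (i + j)) : polar g F ∈ symPow Z j := by
  induction hg using symPow_induction generalizing j with
  | algebraMap c =>
    rw [polar_algebraMap]; rw [zero_add] at hF; exact Submodule.smul_mem _ _ hF
  | add d f g hf hg ihf ihg => rw [map_add, LinearMap.add_apply]; exact add_mem (ihf hF) (ihg hF)
  | ι_mul v hv d f hf ih =>
    rw [polar_mul_apply, polar_ι]
    refine dirDeriv_mem_symPow v (ih ?_)
    rwa [add_assoc, add_comm 1 j] at hF

theorem polar_eq_zero_of_lt {W : Submodule k V} {Z : Submodule k (Dual k V)} {i j : ℕ}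
    {g : SymmetricAlgebra k V} (hg : g ∈ symPow W i) {F : SymmetricAlgebra k (Dual k V)}
    (hF : F ∈ symPow Z j) (hij : j < i) : polar g F = 0 := by
  induction hg using symPow_induction with
  | algebraMap c => omega
  | add d f g hf hg ihf ihg => rw [map_add, LinearMap.add_apply, ihf hij, ihg hij, add_zero]
  | ι_mul v hv d f hf ih =>
    rw [polar_mul_apply, polar_ι]
    rcases Nat.lt_succ_iff_lt_or_eq.1 hij with h | rfl
    · rw [ih h, map_zero]
    · exact dirDeriv_eq_zero_of_mem_symPow_zero v (polar_mem_symPow (j := 0) hf hF)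

/-- Euler's formula. -/
theorem sum_coord_mul_dirDeriv {n : ℕ} (b : Basis (Fin n) k V) {m : ℕ}
    {F : SymmetricAlgebra k (Dual k V)} (hF : F ∈ symPow (⊤ : Submodule k (Dual k V)) m) :
    ∑ i, SymmetricAlgebra.ι k (Dual k V) (b.coord i) * dirDeriv (b i) F = (m : k) • F := by
  induction hF using symPow_induction with
  | algebraMap c => simp [dirDeriv_algebraMap]
  | add d f g hf hg ihf ihg =>
    simp only [map_add, mul_add, Finset.sum_add_distrib, ihf, ihg, smul_add]
  | ι_mul φ hφ d f hf ih =>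
    have h1 : ∑ i, SymmetricAlgebra.ι k (Dual k V) (b.coord i) *
        (algebraMap k (SymmetricAlgebra k (Dual k V)) (φ (b i)) * f) =
        SymmetricAlgebra.ι k (Dual k V) φ * f := by
      conv_rhs => rw [← b.sum_dual_apply_smul_coord φ, map_sum, Finset.sum_mul]
      refine Finset.sum_congr rfl fun i _ => ?_
      rw [map_smul, Algebra.smul_def]; ring
    simp only [dirDeriv_mul, dirDeriv_ι, mul_add, Finset.sum_add_distrib, h1]
    simp only [mul_left_comm _ (SymmetricAlgebra.ι k (Dual k V) φ)]
    rw [← Finset.mul_sum, ih, mul_smul_comm, Nat.cast_add, Nat.cast_one, add_smul, one_smul]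

theorem dirDeriv_eq_zero_of_vanishing {v : V} {Z : Submodule k (Dual k V)}
    (hv : ∀ φ ∈ Z, φ v = 0) {d : ℕ} {F : SymmetricAlgebra k (Dual k V)} (hF : F ∈ symPow Z d) :
    dirDeriv v F = 0 := by
  induction hF using symPow_induction with
  | algebraMap c => exact dirDeriv_algebraMap v c
  | add d f g hf hg ihf ihg => rw [map_add, ihf, ihg, add_zero]
  | ι_mul φ hφ d f hf ih => rw [dirDeriv_mul, dirDeriv_ι, ih, hv φ hφ, map_zero]; ring

/-- If `V = W + W'` and the subspace `Z` of `V^∨` vanishes on `W`, then the polar pairing of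
`Sym^m W'` and `Sym^m Z` is nondegenerate on the right in small degree. -/
theorem eq_zero_of_forall_polar_eq_zero_of_vanishing [FiniteDimensional k V]
    {W W' : Submodule k V} (hW : W ⊔ W' = ⊤) {Z : Submodule k (Dual k V)}
    (hZ : ∀ φ ∈ Z, ∀ w ∈ W, φ w = 0) {m : ℕ} (hm : ∀ i, i ≠ 0 → i ≤ m → (i : k) ≠ 0)
    {F : SymmetricAlgebra k (Dual k V)} (hF : F ∈ symPow Z m)
    (h : ∀ g ∈ symPow W' m, polar g F = 0) : F = 0 := by
  induction m generalizing F with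
  | zero =>
    have := h 1 (by rw [symPow_zero]; exact Submodule.one_le.1 le_rfl)
    rwa [map_one] at this
  | succ m ih =>
    have key' (v : V) (hv : v ∈ W') : dirDeriv v F = 0 := by
      refine ih (fun i h0 hi => hm i h0 (by omega)) (dirDeriv_mem_symPow v hF) fun g hg => ?_
      rw [← polar_ι, ← polar_mul_apply]
      exact h _ (mul_mem_symPow hg (ι_mem_symPow hv))
    -- Derivatives along `W'` vanish by induction, those along `W` because `Z` vanishes there.
    -- Euler's formula then gives `(m + 1) • F = 0`.
    have key (v : V) : dirDeriv v F = 0 := by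
      obtain ⟨w, hw, w', hw', rfl⟩ := Submodule.mem_sup.1 (hW ▸ Submodule.mem_top : v ∈ W ⊔ W')
      rw [dirDeriv_add, LinearMap.add_apply, key' w' hw',
        dirDeriv_eq_zero_of_vanishing (fun φ hφ => hZ φ hφ w hw) hF, add_zero]
    have := sum_coord_mul_dirDeriv (finBasis k V) (symPow_mono le_top _ hF)
    simp only [key, mul_zero, Finset.sum_const_zero] at this
    exact (smul_eq_zero.1 this.symm).resolve_left (hm _ (by omega) le_rfl)

/-- The polar pairing of `Sym^m V` and `Sym^m V^∨` is nondegenerate in small degree. -/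
theorem eq_zero_of_forall_polar_eq_zero [FiniteDimensional k V] {m : ℕ}
    (hm : ∀ i, i ≠ 0 → i ≤ m → (i : k) ≠ 0)
    {F : SymmetricAlgebra k (Dual k V)} (hF : F ∈ symPow (⊤ : Submodule k (Dual k V)) m)
    (h : ∀ g ∈ symPow (⊤ : Submodule k V) m, polar g F = 0) : F = 0 :=
  eq_zero_of_forall_polar_eq_zero_of_vanishing (W := ⊥) (by simp) (by simp) hm hF h

/-- The linear functional on `Sym V` that is given by a form of `Sym V^∨`. -/
def polarFunctional :
    SymmetricAlgebra k (Dual k V) →ₗ[k] Dual k (SymmetricAlgebra k V) :=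
  (polar (k := k) (V := V)).toLinearMap.flip.compr₂
    (SymmetricAlgebra.algebraMapInv (R := k) (M := Dual k V)).toLinearMap

theorem algebraMap_polarFunctional {m : ℕ} {F : SymmetricAlgebra k (Dual k V)}
    (hF : F ∈ symPow (⊤ : Submodule k (Dual k V)) m) {g : SymmetricAlgebra k V}
    (hg : g ∈ symPow (⊤ : Submodule k V) m) :
    algebraMap k _ (polarFunctional F g) = polar g F := by
  obtain ⟨c, hc⟩ := mem_symPow_zero (polar_mem_symPow (j := 0) hg hF)
  change algebraMap k _ (SymmetricAlgebra.algebraMapInv (R := k) (polar g F)) = polar g F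
  rw [← hc, AlgHom.commutes]; rfl

/-- In small degree `m`, each linear functional on `Sym^m V` is given by a form. -/
theorem exists_polar_eq [FiniteDimensional k V] {m : ℕ} (hm : ∀ i, i ≠ 0 → i ≤ m → (i : k) ≠ 0)
    (f : Dual k (symPow (⊤ : Submodule k V) m)) :
    ∃ F ∈ symPow (⊤ : Submodule k (Dual k V)) m, ∀ g : symPow (⊤ : Submodule k V) m,
      polar (g : SymmetricAlgebra k V) F = algebraMap k _ (f g) := by
  let B : symPow (⊤ : Submodule k (Dual k V)) m →ₗ[k] Dual k (symPow (⊤ : Submodule k V) m) :=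
    (symPow (⊤ : Submodule k V) m).dualRestrict ∘ₗ polarFunctional ∘ₗ Submodule.subtype _
  have hB (F) (g) : algebraMap k _ (B F g) = polar (g : SymmetricAlgebra k V) F :=
    algebraMap_polarFunctional F.2 g.2
  have hinj : Function.Injective B := by
    rw [← LinearMap.ker_eq_bot, LinearMap.ker_eq_bot']
    intro F hF
    refine Subtype.ext (eq_zero_of_forall_polar_eq_zero hm F.2 fun g hg => ?_)
    rw [← hB F ⟨g, hg⟩, hF, LinearMap.zero_apply, map_zero]
  have hsurj := (LinearMap.injective_iff_surjective_of_finrank_eq_finrank (by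
    rw [Subspace.dual_finrank_eq]
    exact finrank_symPow_top_eq (finBasis k V).toDualEquiv.symm m)).1 hinj
  obtain ⟨F, rfl⟩ := hsurj f
  exact ⟨F, F.2, fun g => (hB F g).symm⟩

end Polar

/-! ### Existence and uniqueness of the associated form. -/

section AssociatedForm

open RingTheory.Sequence

variable {k V : Type*} [Field k] [AddCommGroup V] [Module k V]

/-- Through the nondegenerate pairing both forms are functionals on `Sym^m V`, and an inclusion of
kernels makes functionals proportional. -/
theorem exists_smul_eq_of_polar_eq_zero [FiniteDimensional k V] {m : ℕ} (hm : ∀ i, i ≠ 0 → i ≤ m → (i : k) ≠ 0)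
    {F G : SymmetricAlgebra k (Dual k V)} (hF : F ∈ symPow (⊤ : Submodule k (Dual k V)) m)
    (hG : G ∈ symPow (⊤ : Submodule k (Dual k V)) m)
    (h : ∀ g ∈ symPow (⊤ : Submodule k V) m, polar g F = 0 → polar g G = 0) :
    ∃ c : k, G = c • F := by
  by_cases h0 : ∃ g₀ ∈ symPow (⊤ : Submodule k V) m, polar g₀ F ≠ 0
  · obtain ⟨g₀, hg₀, hne⟩ := h0
    obtain ⟨a, ha⟩ := mem_symPow_zero (polar_mem_symPow (j := 0) hg₀ hF)
    obtain ⟨b, hb⟩ := mem_symPow_zero (polar_mem_symPow (j := 0) hg₀ hG)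
    have ha0 : a ≠ 0 := by rintro rfl; exact hne (by rw [← ha, map_zero])
    refine ⟨b / a, sub_eq_zero.1 (eq_zero_of_forall_polar_eq_zero hm
      (sub_mem hG (Submodule.smul_mem _ _ hF)) fun g hg => ?_)⟩
    obtain ⟨c, hc⟩ := mem_symPow_zero (polar_mem_symPow (j := 0) hg hF)
    have := h (g - (c / a) • g₀) (sub_mem hg (Submodule.smul_mem _ _ hg₀)) (by
      rw [map_sub, map_smul, LinearMap.sub_apply, LinearMap.smul_apply, ← hc, ← ha,
        Algebra.smul_def, ← map_mul, div_mul_cancel₀ _ ha0, sub_self])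
    rw [map_sub, map_smul, LinearMap.sub_apply, LinearMap.smul_apply, sub_eq_zero] at this
    rw [map_sub, map_smul, this, ← hb, ← hc, Algebra.smul_def,
      Algebra.smul_def, ← map_mul, ← map_mul, div_mul_comm, sub_self]
  · push Not at h0
    refine ⟨0, ?_⟩
    rw [zero_smul]
    exact eq_zero_of_forall_polar_eq_zero hm hG fun g hg => h g hg (h0 g hg)

/-- The polynomials `g` with `g ∘ F = 0` form a homogeneous ideal if `F` is a form. -/
theorem polar_decompose_eq_zero {m : ℕ} {F : SymmetricAlgebra k (Dual k V)}
    (hF : F ∈ symPow (⊤ : Submodule k (Dual k V)) m) {g : SymmetricAlgebra k V}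
    (hg : polar g F = 0) (j : ℕ) :
    polar (DirectSum.decompose (fun i => symPow (⊤ : Submodule k V) i) g j :
      SymmetricAlgebra k V) F = 0 := by
  classical
  set 𝒜 := fun i => symPow (⊤ : Submodule k V) i
  rcases lt_or_ge m j with hj | hj
  · exact polar_eq_zero_of_lt (SetLike.coe_mem (DirectSum.decompose 𝒜 g j)) hF hj
  rw [← DirectSum.sum_support_decompose 𝒜 g, map_sum, LinearMap.sum_apply] at hg
  -- The components of `g` send `F` to forms of different degrees `m - i`, so no cancellation
  -- between them is possible.
  have h := congrArg
    (GradedRing.proj (fun i => symPow (⊤ : Submodule k (Dual k V)) i) (m - j)) hg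
  simp only [map_sum, map_zero, GradedRing.proj_apply] at h
  have hmem (i : ℕ) (hi : i ≤ m) : polar (DirectSum.decompose 𝒜 g i : SymmetricAlgebra k V) F ∈
      symPow (⊤ : Submodule k (Dual k V)) (m - i) :=
    polar_mem_symPow (SetLike.coe_mem (DirectSum.decompose 𝒜 g i))
      (by rwa [Nat.add_sub_cancel' hi])
  rw [Finset.sum_eq_single j] at h
  · rwa [DirectSum.decompose_of_mem_same _ (hmem j hj)] at h
  · intro i _ hij
    rcases lt_or_ge m i with hi | hi
    · rw [polar_eq_zero_of_lt (SetLike.coe_mem (DirectSum.decompose 𝒜 g i)) hF hi]; simp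
    · have hne : m - i ≠ m - j := by omega
      exact DirectSum.decompose_of_mem_ne _ (hmem i hi) hne
  · intro hj
    rw [DFinsupp.notMem_support_iff.1 hj]; simp

/-- Existence of the associated form: the Macaulay inverse system of a complete intersection. -/
theorem exists_polar_eq_zero_iff [FiniteDimensional k V] {d : ℕ} (hd : d ≠ 0) {rs : List (SymmetricAlgebra k V)}
    (hlen : rs.length = finrank k V) (hrs : ∀ r ∈ rs, r ∈ symPow (⊤ : Submodule k V) d)
    (hreg : IsWeaklyRegular (SymmetricAlgebra k V) rs)
    (hm : ∀ i, i ≠ 0 → i ≤ finrank k V * (d - 1) → (i : k) ≠ 0) :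
    ∃ F ∈ symPow (⊤ : Submodule k (Dual k V)) (finrank k V * (d - 1)),
      ∀ g, g ∈ Ideal.ofList rs ↔ polar g F = 0 := by
  classical
  set N := finrank k V * (d - 1) with hN
  set I := Ideal.ofList rs with hI
  set 𝒜 := fun i => symPow (⊤ : Submodule k V) i
  have hIhom : I.IsHomogeneous 𝒜 := isHomogeneous_ofList 𝒜 hrs
  obtain ⟨w, hw, hwI⟩ := exists_notMem_ofList hd hlen hrs hreg
  let J : Submodule k (symPow (⊤ : Submodule k V) N) :=
    (I.restrictScalars k).comap (Submodule.subtype _)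
  -- The part of `I` in degree `N` is a hyperplane not containing `w`, so a functional that kills it
  -- but not `w` has exactly this kernel.
  obtain ⟨f, hfw, hfJ⟩ := Submodule.exists_dual_map_eq_bot_of_notMem (p := J) (x := ⟨w, hw⟩)
    hwI inferInstance
  obtain ⟨F, hF, hfF⟩ := exists_polar_eq hm f
  have hkill : ∀ g ∈ symPow (⊤ : Submodule k V) N, g ∈ I ↔ polar g F = 0 := by
    intro g hg
    have hiff : polar g F = 0 ↔ f ⟨g, hg⟩ = 0 := by
      rw [hfF ⟨g, hg⟩]; simp
    rw [hiff]
    have hz : ∀ x : symPow (⊤ : Submodule k V) N, (x : SymmetricAlgebra k V) ∈ I → f x = 0 := by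
      intro x hx
      have : f x ∈ J.map f := Submodule.mem_map_of_mem hx
      rwa [hfJ, Submodule.mem_bot] at this
    refine ⟨hz ⟨g, hg⟩, fun h => ?_⟩
    obtain ⟨c, hc⟩ := exists_smul_sub_mem hd hlen hrs hreg hw hwI (u := g) fun v =>
      symPow_le_ofList hd hlen hrs hreg (by omega) (mul_mem_symPow (ι_mem_symPow trivial) hg)
    have h1 := hz (⟨g, hg⟩ - c • ⟨w, hw⟩) hc
    rw [map_sub, h, map_smul, zero_sub, neg_eq_zero, smul_eq_mul] at h1
    have : c = 0 := (mul_eq_zero.1 h1).resolve_right hfw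
    rw [this, zero_smul, sub_zero] at hc
    exact hc
  -- Descending induction on the degree. If `g ∈ I`, all first derivatives of `g ∘ F` vanish and
  -- Euler's formula applies in degree `e + 1`. If `g ∘ F = 0`, then `V g ⊆ I`, and `I` has no socle
  -- below degree `N`.
  have hhom : ∀ e j, j + e = N → ∀ g ∈ symPow (⊤ : Submodule k V) j,
      g ∈ I ↔ polar g F = 0 := by
    intro e
    induction e with
    | zero => rintro j rfl g hg; exact hkill g hg
    | succ e ih =>
      intro j hj g hg
      have step (v : V) := ih (j + 1) (by omega) (SymmetricAlgebra.ι k V v * g)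
        (by rw [add_comm]; exact mul_mem_symPow (ι_mem_symPow trivial) hg)
      constructor
      · intro h
        have hmem : polar g F ∈ symPow (⊤ : Submodule k (Dual k V)) (e + 1) :=
          polar_mem_symPow hg (by rwa [hj])
        have := sum_coord_mul_dirDeriv (finBasis k V) hmem
        simp only [← polar_ι, ← polar_mul_apply, (step _).1 (Ideal.mul_mem_left _ _ h), mul_zero,
          Finset.sum_const_zero] at this
        exact (smul_eq_zero.1 this.symm).resolve_left (hm _ (by omega) (by omega))
      · intro h
        refine mem_of_forall_ι_mul_mem hd hlen hrs hreg (j := j) (by omega) hg fun v => ?_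
        rw [step v, polar_mul_apply, h, map_zero]
  have hdeg : ∀ j, ∀ g ∈ symPow (⊤ : Submodule k V) j, g ∈ I ↔ polar g F = 0 := by
    intro j g hg
    rcases lt_or_ge N j with hj | hj
    · exact iff_of_true (symPow_le_ofList hd hlen hrs hreg hj hg) (polar_eq_zero_of_lt hg hF hj)
    · exact hhom (N - j) j (by omega) g hg
  refine ⟨F, hF, fun g => ⟨fun h => ?_, fun h => ?_⟩⟩
  · rw [← DirectSum.sum_support_decompose 𝒜 g, map_sum, LinearMap.sum_apply]
    exact Finset.sum_eq_zero fun i _ => (hdeg i _ (SetLike.coe_mem _)).1 (hIhom i h)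
  · rw [← DirectSum.sum_support_decompose 𝒜 g]
    exact Ideal.sum_mem _ fun i _ => (hdeg i _ (SetLike.coe_mem _)).2
      (polar_decompose_eq_zero hF h i)

end AssociatedForm

/-! ### Restriction of a complete intersection to a direct summand. -/

section Retraction

open RingTheory.Sequence

/-- A weakly regular sequence that lies in a retract of a ring is weakly regular there. -/
theorem IsWeaklyRegular.map_of_retraction {A B : Type*} [CommRing A] [CommRing B] (ρ : A →+* B)
    (σ : B →+* A) (hρσ : ∀ x, ρ (σ x) = x) {rs : List A} (hrs : ∀ r ∈ rs, σ (ρ r) = r)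
    (h : IsWeaklyRegular A rs) : IsWeaklyRegular B (rs.map ρ) := by
  induction rs using List.reverseRecOn with
  | nil => simp
  | append_singleton rs g ih =>
    simp only [List.mem_append, List.mem_singleton] at hrs
    have hrs' : ∀ r ∈ rs, σ (ρ r) = r := fun r hr => hrs r (.inl hr)
    rw [isWeaklyRegular_concat_iff] at h
    rw [List.map_append, List.map_singleton, isWeaklyRegular_concat_iff]
    refine ⟨ih hrs' h.1, le_antisymm (fun u hu => ?_) fun u hu => Ideal.mul_mem_right _ _ hu⟩
    have h1 : Ideal.map ρ (Ideal.ofList rs) = Ideal.ofList (rs.map ρ) := Ideal.map_ofList _ _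
    have h2 : Ideal.map σ (Ideal.ofList (rs.map ρ)) = Ideal.ofList rs := by
      rw [Ideal.map_ofList, List.map_map]
      congr 1
      exact (List.map_congr_left hrs').trans (List.map_id' rs)
    rw [mem_colonIdeal] at hu
    have h3 := Ideal.mem_map_of_mem σ hu
    rw [h2, map_mul, hrs g (.inr rfl), ← mem_colonIdeal, h.2] at h3
    have h4 := Ideal.mem_map_of_mem ρ h3
    rwa [h1, hρσ] at h4

variable {k V : Type*} [Field k] [AddCommGroup V] [Module k V]

theorem ideal_span_submodule_span {R : Type*} [CommRing R] [Algebra k R] (s : Set R) :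
    Ideal.span (Submodule.span k s : Set R) = Ideal.span s :=
  Submodule.span_span_of_tower k R s

theorem exists_list_of_mem_grassRes {n d : ℕ} {U : Submodule k (SymmetricAlgebra k V)}
    (hU : U ∈ grassRes k V n d) :
    ∃ rs : List (SymmetricAlgebra k V), rs.length = n ∧
      (∀ r ∈ rs, r ∈ symPow (⊤ : Submodule k V) d) ∧
      IsWeaklyRegular (SymmetricAlgebra k V) rs ∧ Ideal.ofList rs = Ideal.span U := by
  obtain ⟨hUd, -, g, hg, hreg⟩ := hU
  refine ⟨List.ofFn g, by simp, fun r hr => ?_, hreg.toIsWeaklyRegular, ?_⟩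
  · obtain ⟨i, rfl⟩ := List.mem_ofFn.1 hr
    exact hUd (hg ▸ Submodule.subset_span ⟨i, rfl⟩)
  · rw [← hg, ideal_span_submodule_span, Ideal.ofList]
    congr 1
    ext; simp [List.mem_ofFn]

/-- The members of a basis of a finite-dimensional subspace. -/
def basisList {E : Type*} [AddCommGroup E] [Module k E] (L : Submodule k E)
    [FiniteDimensional k L] : List E :=
  List.ofFn fun i : Fin (finrank k L) => (finBasis k L i : E)

section BasisList

variable {E : Type*} [AddCommGroup E] [Module k E] (L : Submodule k E) [FiniteDimensional k L]

theorem length_basisList : (basisList L).length = finrank k L := List.length_ofFn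

theorem span_basisList : Submodule.span k {r | r ∈ basisList L} = L := by
  have h : {r | r ∈ basisList L} = L.subtype '' Set.range (finBasis k L) := by
    ext r; simp [basisList, List.mem_ofFn]
  rw [h, Submodule.span_image, (finBasis k L).span_eq, Submodule.map_subtype_top]

theorem mem_of_mem_basisList {r : E} (hr : r ∈ basisList L) : r ∈ L := by
  obtain ⟨i, rfl⟩ := List.mem_ofFn.1 hr
  exact SetLike.coe_mem _

end BasisList

theorem ofList_basisList {R : Type*} [CommRing R] [Algebra k R] (L : Submodule k R)
    [FiniteDimensional k L] : Ideal.ofList (basisList L) = Ideal.span L := by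
  conv_rhs => rw [← span_basisList L, ideal_span_submodule_span]

theorem ideal_span_sup {R : Type*} [CommRing R] [Algebra k R] (L₁ L₂ : Submodule k R) :
    Ideal.span ((L₁ ⊔ L₂ : Submodule k R) : Set R) = Ideal.span L₁ ⊔ Ideal.span L₂ := by
  rw [← Ideal.span_union, ← ideal_span_submodule_span (k := k) (L₁ ∪ L₂ : Set R),
    Submodule.span_union, Submodule.span_eq, Submodule.span_eq]

variable [FiniteDimensional k V]

/-- If `U = L₁ + L₂` as in a balanced direct sum, then `L₁` gives a complete intersection
in `Sym W₁`. -/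
theorem exists_isWeaklyRegular_retract {n d : ℕ} (hd : d ≠ 0)
    {U L₁ L₂ : Submodule k (SymmetricAlgebra k V)} (hU : U ∈ grassRes k V n d)
    {W₁ W₂ : Submodule k V} (hW : IsCompl W₁ W₂) (hL₁ : L₁ ≤ symPow W₁ d)
    (hL₂ : L₂ ≤ symPow W₂ d) (hsum : U = L₁ ⊔ L₂) (hdim : finrank k L₁ + finrank k L₂ = n) :
    ∃ rs : List (SymmetricAlgebra k W₁), rs.length = finrank k L₁ ∧
      (∀ r ∈ rs, r ∈ symPow (⊤ : Submodule k W₁) d) ∧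
      IsWeaklyRegular (SymmetricAlgebra k W₁) rs ∧
      ∀ f ∈ Ideal.span (U : Set (SymmetricAlgebra k V)),
        symMap (W₁.projectionOnto W₂ hW) f ∈ Ideal.ofList rs := by
  have : FiniteDimensional k L₁ := Submodule.finiteDimensional_of_le hL₁
  have : FiniteDimensional k L₂ := Submodule.finiteDimensional_of_le hL₂
  obtain ⟨gs, hgs, hgd, hgreg, hgU⟩ := exists_list_of_mem_grassRes hU
  have hU' : Ideal.span (U : Set (SymmetricAlgebra k V)) = Ideal.span L₁ ⊔ Ideal.span L₂ := by
    rw [hsum, ideal_span_sup]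
  -- The concatenated bases are `n` forms generating `I_U`, hence regular; listing `L₁` first makes
  -- its basis a regular prefix.
  have hreg : IsWeaklyRegular (SymmetricAlgebra k V) (basisList L₁ ++ basisList L₂) := by
    refine isWeaklyRegular_of_ofList_eq (fun i => symPow (⊤ : Submodule k V) i) hd hgd
      (fun r hr => ?_) ?_ ?_ hgreg
    · rcases List.mem_append.1 hr with h | h
      · exact symPow_mono le_top d (hL₁ (mem_of_mem_basisList _ h))
      · exact symPow_mono le_top d (hL₂ (mem_of_mem_basisList _ h))
    · rw [hgs, List.length_append, length_basisList, length_basisList, hdim]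
    · rw [hgU, hU', Ideal.ofList_append, ofList_basisList, ofList_basisList]
  obtain ⟨ρ, hρ⟩ : ∃ ρ : SymmetricAlgebra k V →+* SymmetricAlgebra k W₁,
      ∀ f, ρ f = symMap (W₁.projectionOnto W₂ hW) f :=
    ⟨(symMap (W₁.projectionOnto W₂ hW)).toRingHom, fun _ => rfl⟩
  obtain ⟨σ, hσ⟩ : ∃ σ : SymmetricAlgebra k W₁ →+* SymmetricAlgebra k V,
      ∀ f, σ f = symMap W₁.subtype f := ⟨(symMap W₁.subtype).toRingHom, fun _ => rfl⟩
  simp only [← hρ]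
  have hρσ (x) : ρ (σ x) = x := by
    rw [hρ, hσ, symMap_symMap, Submodule.projectionOnto_comp_subtype, symMap_id]
  have hσρ : ∀ f ∈ L₁, σ (ρ f) = f := by
    intro f hf
    rw [hρ, hσ, symMap_symMap]
    refine symMap_eq_self (fun v hv => ?_) (hL₁ hf)
    exact Submodule.projection_apply_of_mem_left hW hv
  refine ⟨(basisList L₁).map ρ, by rw [List.length_map, length_basisList], fun r hr => ?_,
    IsWeaklyRegular.map_of_retraction ρ σ hρσ
      (fun r hr => hσρ r (mem_of_mem_basisList _ hr))
      ((isWeaklyRegular_append_iff _ _ _).1 hreg).1, fun f hf => ?_⟩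
  · obtain ⟨f, hf, rfl⟩ := List.mem_map.1 hr
    rw [hρ]
    exact symMap_mem_symPow _ le_top (hL₁ (mem_of_mem_basisList _ hf))
  · have h1 : Ideal.ofList ((basisList L₁).map ρ) =
        Ideal.map ρ (Ideal.span (L₁ : Set (SymmetricAlgebra k V))) := by
      rw [← ofList_basisList, Ideal.map_ofList]
    have h2 : Ideal.map ρ (Ideal.span (L₂ : Set (SymmetricAlgebra k V))) = ⊥ := by
      rw [Ideal.map_span, Ideal.span_eq_bot]
      rintro _ ⟨f, hf, rfl⟩
      rw [hρ]
      exact symMap_eq_zero (fun v hv => (Submodule.projectionOnto_apply_eq_zero_iff hW).2 hv) hd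
        (hL₂ hf)
    rw [hU'] at hf
    have h3 := Ideal.mem_map_of_mem ρ hf
    rwa [Ideal.map_sup, h2, sup_bot_eq, ← h1] at h3

/-- A complete intersection of finite length needs as many equations as there are variables. -/
theorem finrank_le_length {d : ℕ} (hd : d ≠ 0) {rs : List (SymmetricAlgebra k V)}
    (hrs : ∀ r ∈ rs, r ∈ symPow (⊤ : Submodule k V) d)
    (hreg : IsWeaklyRegular (SymmetricAlgebra k V) rs) {N : ℕ}
    (hN : ∀ j, N < j → ∀ f ∈ symPow (⊤ : Submodule k V) j, f ∈ Ideal.ofList rs) :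
    finrank k V ≤ rs.length := by
  by_contra! hlt
  obtain ⟨s, hs⟩ := Nat.exists_eq_add_of_lt hlt
  have h := one_sub_X_pow_mul_hilb hd hrs hreg
  set H := hilb (fun i => symPow (⊤ : Submodule k V) i) (Ideal.ofList rs) with hH
  -- With fewer equations than variables, the polynomial `H` satisfies `(1 - X)^(s+1) H = (1 + ... +
  -- X^(d-1))^r`, where `r` is the number of equations; evaluation at `1` gives `0 = d^r`.
  have hpoly : H = (PowerSeries.trunc (N + 1) H : PowerSeries ℤ) := by
    ext j
    rw [Polynomial.coeff_coe, PowerSeries.coeff_trunc]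
    split_ifs with hj
    · rfl
    · rw [hH, hilb, PowerSeries.coeff_mk, inf_eq_left.2 (hN j (by omega)), sub_self]
  set E : Polynomial ℤ := ∑ i ∈ Finset.range d, Polynomial.X ^ i with hE
  have hE' : (1 - PowerSeries.X ^ d : PowerSeries ℤ) = (1 - PowerSeries.X) * (E : PowerSeries ℤ) := by
    rw [← mul_neg_geom_sum, hE]
    congr 1
    rw [← Polynomial.coeToPowerSeries.ringHom_apply, map_sum]
    simp
  rw [hE', mul_pow, hs, add_assoc, pow_add, mul_assoc, hpoly] at h
  have h2 := mul_left_cancel₀ (pow_ne_zero _ one_sub_X_ne_zero) h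
  have h3 : (1 - Polynomial.X) ^ (s + 1) * PowerSeries.trunc (N + 1) H = E ^ rs.length := by
    apply Polynomial.coe_injective
    simpa using h2
  have h4 := congrArg (Polynomial.eval 1) h3
  rw [Polynomial.eval_mul, Polynomial.eval_pow, Polynomial.eval_pow, hE,
    Polynomial.eval_finsetSum] at h4
  simp only [sub_self, Polynomial.eval_sub, Polynomial.eval_one, Polynomial.eval_X, ne_eq,
    Nat.add_eq_zero_iff, one_ne_zero, and_false, not_false_eq_true, zero_pow, zero_mul, one_pow,
    Polynomial.eval_pow, Finset.sum_const, Finset.card_range, nsmul_eq_mul, mul_one] at h4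
  exact pow_ne_zero _ (Nat.cast_ne_zero.2 hd) h4.symm

end Retraction

/-! ### Naturality of the polar pairing and products of forms. -/

section Naturality

variable {k V W : Type*} [Field k] [AddCommGroup V] [Module k V] [AddCommGroup W] [Module k W]

theorem dirDeriv_symMap_dualMap (T : V →ₗ[k] W) (v : V) (F : SymmetricAlgebra k (Dual k W)) :
    dirDeriv v (symMap T.dualMap F) = symMap T.dualMap (dirDeriv (T v) F) := by
  induction F using SymmetricAlgebra.induction with
  | algebraMap c => simp [dirDeriv_algebraMap]
  | ι φ => simp [dirDeriv_ι]
  | mul F G hF hG => simp only [map_mul, dirDeriv_mul, hF, hG, map_add]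
  | add F G hF hG => simp only [map_add, hF, hG]

/-- Naturality of the polar pairing. -/
theorem polar_symMap_dualMap (T : V →ₗ[k] W) (g : SymmetricAlgebra k V)
    (F : SymmetricAlgebra k (Dual k W)) :
    polar g (symMap T.dualMap F) = symMap T.dualMap (polar (symMap T g) F) := by
  induction g using SymmetricAlgebra.induction generalizing F with
  | algebraMap c => rw [AlgHom.commutes (symMap T), polar_algebraMap, polar_algebraMap, map_smul]
  | ι v => rw [symMap_ι, polar_ι, polar_ι, dirDeriv_symMap_dualMap]
  | mul f g hf hg => rw [map_mul (symMap T), polar_mul_apply, polar_mul_apply, hg, hf]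
  | add f g hf hg => simp only [map_add, LinearMap.add_apply, hf, hg]

theorem polar_mul_right_of_vanishing {W : Submodule k V} {Z : Submodule k (Dual k V)}
    (hWZ : ∀ φ ∈ Z, ∀ w ∈ W, φ w = 0) {i j : ℕ} {g : SymmetricAlgebra k V}
    (hg : g ∈ symPow W i) {F₂ : SymmetricAlgebra k (Dual k V)} (hF₂ : F₂ ∈ symPow Z j)
    (F₁ : SymmetricAlgebra k (Dual k V)) : polar g (F₁ * F₂) = polar g F₁ * F₂ := by
  induction hg using symPow_induction with
  | algebraMap c => rw [polar_algebraMap, polar_algebraMap, smul_mul_assoc]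
  | add d f g hf hg ihf ihg => simp only [map_add, LinearMap.add_apply, ihf, ihg, add_mul]
  | ι_mul v hv d f hf ih =>
    rw [polar_mul_apply, polar_mul_apply, ih, polar_ι, dirDeriv_mul,
      dirDeriv_eq_zero_of_vanishing (fun φ hφ => hWZ φ hφ v hv) hF₂, mul_zero, zero_add]

theorem polar_mul_left_of_vanishing {W : Submodule k V} {Z : Submodule k (Dual k V)}
    (hWZ : ∀ φ ∈ Z, ∀ w ∈ W, φ w = 0) {i j : ℕ} {g : SymmetricAlgebra k V}
    (hg : g ∈ symPow W i) {F₁ : SymmetricAlgebra k (Dual k V)} (hF₁ : F₁ ∈ symPow Z j)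
    (F₂ : SymmetricAlgebra k (Dual k V)) : polar g (F₁ * F₂) = F₁ * polar g F₂ := by
  rw [mul_comm, polar_mul_right_of_vanishing hWZ hg hF₁, mul_comm]

theorem polar_eq_zero_of_mem_span {U : Set (SymmetricAlgebra k V)}
    {F : SymmetricAlgebra k (Dual k V)} (hU : ∀ g ∈ U, polar g F = 0) :
    ∀ g ∈ Ideal.span U, polar g F = 0 := by
  intro g hg
  induction hg using Submodule.span_induction with
  | mem x hx => exact hU x hx
  | zero => simp
  | add x y _ _ hx hy => rw [map_add, LinearMap.add_apply, hx, hy, add_zero]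
  | smul a x _ hx => rw [smul_eq_mul, polar_mul_apply, hx, map_zero]

end Naturality

/-! ### From a balanced direct sum to a balanced direct product. -/

section Forward

open RingTheory.Sequence

variable {k V : Type*} [Field k] [AddCommGroup V] [Module k V] [FiniteDimensional k V]

/-- The factor is the inverse system of the complete intersection cut out by `L₁` in `Sym W₁`,
pulled back along the projection `V → W₁`; pulled-back functionals vanish on `W₂`. -/
theorem exists_factor {n d : ℕ} (hd : d ≠ 0)
    {U L₁ L₂ : Submodule k (SymmetricAlgebra k V)} (hU : U ∈ grassRes k V n d)
    (hm : ∀ i, i ≠ 0 → i ≤ n * (d - 1) → (i : k) ≠ 0)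
    {W₁ W₂ : Submodule k V} (hW : IsCompl W₁ W₂) (hL₁ : L₁ ≤ symPow W₁ d)
    (hL₂ : L₂ ≤ symPow W₂ d) (hsum : U = L₁ ⊔ L₂) (hdim : finrank k L₁ + finrank k L₂ = n)
    (h₁ : finrank k L₁ = finrank k W₁) :
    ∃ F ∈ symPow W₂.dualAnnihilator (finrank k W₁ * (d - 1)), F ≠ 0 ∧
      ∀ f ∈ L₁, polar f F = 0 := by
  obtain ⟨rs, hlen, hrs, hreg, hker⟩ :=
    exists_isWeaklyRegular_retract hd hU hW hL₁ hL₂ hsum hdim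
  have hle : finrank k W₁ * (d - 1) ≤ n * (d - 1) := Nat.mul_le_mul_right _ (by omega)
  obtain ⟨F, hF, hFrs⟩ := exists_polar_eq_zero_iff hd (hlen.trans h₁) hrs hreg
    fun i h0 hi => hm i h0 (hi.trans hle)
  have hF0 : F ≠ 0 := by
    rintro rfl
    obtain ⟨w, -, hw⟩ := exists_notMem_ofList hd (hlen.trans h₁) hrs hreg
    exact hw ((hFrs w).2 (map_zero _))
  set T := W₁.projectionOnto W₂ hW with hT
  have hinj : Function.Injective (symMap T.dualMap) := by
    refine symMap_injective_of_leftInverse (T' := W₁.subtype.dualMap) ?_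
    rw [LinearMap.dualMap_comp_dualMap, hT, Submodule.projectionOnto_comp_subtype,
      LinearMap.dualMap_id]
  refine ⟨symMap T.dualMap F, symMap_mem_symPow _ ?_ hF, ?_, fun f hf => ?_⟩
  · rintro _ ⟨φ, -, rfl⟩
    rw [Submodule.mem_dualAnnihilator]
    intro w hw
    rw [LinearMap.dualMap_apply, (Submodule.projectionOnto_apply_eq_zero_iff hW).2 hw, map_zero]
  · rwa [Ne, map_eq_zero_iff _ hinj]
  · rw [polar_symMap_dualMap, (hFrs _).1 (hker f (Ideal.subset_span ?_)), map_zero]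
    rw [hsum]
    exact Submodule.mem_sup_left hf

theorem isBalancedProductAlong_of_isBalancedSumAlong {n d : ℕ} (hV : finrank k V = n)
    (hd : d ≠ 0) {U : Submodule k (SymmetricAlgebra k V)} (hU : U ∈ grassRes k V n d)
    (hm : ∀ i, i ≠ 0 → i ≤ n * (d - 1) → (i : k) ≠ 0)
    {F : SymmetricAlgebra k (Dual k V)} (hF : IsAssociatedForm n d U F)
    {W₁ W₂ : Submodule k V} (hW : IsCompl W₁ W₂) (h : IsBalancedSumAlong d W₁ W₂ U) :
    IsBalancedProductAlong W₂.dualAnnihilator W₁.dualAnnihilator F := by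
  obtain ⟨L₁, L₂, hL₁, hL₂, h₁, h₂, hsum⟩ := h
  have hn : finrank k W₁ + finrank k W₂ = n := by
    rw [Submodule.finrank_add_eq_of_isCompl hW, hV]
  obtain ⟨F₁, hF₁, hF₁0, hLF₁⟩ := exists_factor hd hU hm hW hL₁ hL₂ hsum (by omega) h₁
  obtain ⟨F₂, hF₂, hF₂0, hLF₂⟩ := exists_factor hd hU hm hW.symm hL₂ hL₁
    (hsum.trans (sup_comm _ _)) (by omega) h₂
  have hne : F₁ * F₂ ≠ 0 := mul_ne_zero hF₁0 hF₂0
  have hdeg : F₁ * F₂ ∈ symPow (⊤ : Submodule k (Dual k V)) (n * (d - 1)) := by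
    rw [← hn, add_mul]
    exact mul_mem_symPow (symPow_mono le_top _ hF₁) (symPow_mono le_top _ hF₂)
  have hkill : ∀ g ∈ Ideal.span (U : Set (SymmetricAlgebra k V)), polar g (F₁ * F₂) = 0 := by
    refine polar_eq_zero_of_mem_span fun g hg => ?_
    obtain ⟨f₁, hf₁, f₂, hf₂, rfl⟩ := Submodule.mem_sup.1 (hsum ▸ hg : g ∈ L₁ ⊔ L₂)
    rw [map_add, LinearMap.add_apply,
      polar_mul_right_of_vanishing (fun φ hφ w hw => (Submodule.mem_dualAnnihilator φ).1 hφ w hw)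
        (hL₁ hf₁) hF₂,
      polar_mul_left_of_vanishing (fun φ hφ w hw => (Submodule.mem_dualAnnihilator φ).1 hφ w hw)
        (hL₂ hf₂) hF₁, hLF₁ f₁ hf₁, hLF₂ f₂ hf₂, zero_mul, mul_zero, add_zero]
  -- `F₁ * F₂` has the degree of `F` and is annihilated by `I_U`, so it is a multiple of `F`.
  obtain ⟨c, hc⟩ := exists_smul_eq_of_polar_eq_zero hm hF.1 hdeg
    fun g _ hg => hkill g ((hF.2 g).2 hg)
  have hc0 : c ≠ 0 := by
    rintro rfl; exact hne (by rw [hc, zero_smul])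
  have hFeq : F = (c⁻¹ • F₁) * F₂ := by
    rw [smul_mul_assoc, hc, smul_smul, inv_mul_cancel₀ hc0, one_smul]
  refine ⟨?_, _, _, c⁻¹ • F₁, F₂, Submodule.smul_mem _ _ hF₁, hF₂, hFeq, ?_⟩
  · rintro rfl; exact hne (by rw [hc, smul_zero])
  · have e₁ := Subspace.finrank_add_finrank_dualAnnihilator_eq W₁
    have e₂ := Subspace.finrank_add_finrank_dualAnnihilator_eq W₂
    have h1 : finrank k W₁.dualAnnihilator = finrank k W₂ := by omega
    have h2 : finrank k W₂.dualAnnihilator = finrank k W₁ := by omega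
    rw [h1, h2]
    ring

end Forward

/-! ### Low degrees of the ideal generated by `U`, and bidegree decompositions. -/

section Backward

open RingTheory.Sequence

variable {k V : Type*} [Field k] [AddCommGroup V] [Module k V]

/-- For a generator `a * x` with `x ∈ U`, the degree-`d` component is the constant term of `a` times
`x`, and nothing lies below. -/
theorem decompose_mem_of_mem_ideal_span {d : ℕ} {U : Submodule k (SymmetricAlgebra k V)}
    (hU : U ≤ symPow ⊤ d) {f : SymmetricAlgebra k V}
    (hf : f ∈ Ideal.span (U : Set (SymmetricAlgebra k V))) {j : ℕ} :
    (j = d → (DirectSum.decompose (fun i => symPow (⊤ : Submodule k V) i) f j :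
      SymmetricAlgebra k V) ∈ U) ∧
    (j < d → (DirectSum.decompose (fun i => symPow (⊤ : Submodule k V) i) f j :
      SymmetricAlgebra k V) = 0) := by
  induction hf using Submodule.closure_induction with
  | zero => simp
  | add x y _ _ hx hy =>
    simp only [DirectSum.decompose_add, DirectSum.add_apply, Submodule.coe_add]
    refine ⟨fun h => add_mem (hx.1 h) (hy.1 h), fun h => ?_⟩
    rw [hx.2 h, hy.2 h, add_zero]
  | smul_mem a x hx =>
    rw [smul_eq_mul, DirectSum.coe_decompose_mul_of_right_mem _ j (hU hx)]
    constructor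
    · rintro rfl
      rw [if_pos le_rfl, Nat.sub_self]
      obtain ⟨c, hc⟩ := mem_symPow_zero (SetLike.coe_mem
        (DirectSum.decompose (fun i => symPow (⊤ : Submodule k V) i) a 0))
      rw [← hc, ← Algebra.smul_def]
      exact Submodule.smul_mem _ _ hx
    · intro h
      rw [if_neg (by omega)]

theorem mem_of_mem_ideal_span {d : ℕ} {U : Submodule k (SymmetricAlgebra k V)}
    (hU : U ≤ symPow ⊤ d) {f : SymmetricAlgebra k V} (hfd : f ∈ symPow (⊤ : Submodule k V) d)
    (hf : f ∈ Ideal.span (U : Set (SymmetricAlgebra k V))) : f ∈ U := by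
  have := (decompose_mem_of_mem_ideal_span hU hf (j := d)).1 rfl
  rwa [DirectSum.decompose_of_mem_same (fun i => symPow (⊤ : Submodule k V) i) hfd] at this

theorem eq_zero_of_mem_ideal_span {d : ℕ} {U : Submodule k (SymmetricAlgebra k V)}
    (hU : U ≤ symPow ⊤ d) {j : ℕ} (hj : j < d) {f : SymmetricAlgebra k V}
    (hfj : f ∈ symPow (⊤ : Submodule k V) j)
    (hf : f ∈ Ideal.span (U : Set (SymmetricAlgebra k V))) : f = 0 := by
  have := (decompose_mem_of_mem_ideal_span hU hf (j := j)).2 hj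
  rwa [DirectSum.decompose_of_mem_same (fun i => symPow (⊤ : Submodule k V) i) hfj] at this

theorem symPow_sup_le (W₁ W₂ : Submodule k V) (d : ℕ) :
    symPow (W₁ ⊔ W₂) d ≤ ⨆ p ∈ Finset.HasAntidiagonal.antidiagonal d, symPow W₁ p.1 * symPow W₂ p.2 := by
  induction d with
  | zero =>
    refine le_trans ?_ (le_iSup₂_of_le (0, 0) (by simp) le_rfl)
    rw [symPow_zero, symPow_zero, symPow_zero, mul_one]
  | succ d ih =>
    rw [symPow_succ, Submodule.map_sup, Submodule.sup_mul]
    refine sup_le ?_ ?_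
    · refine (mul_le_mul' le_rfl ih).trans ?_
      simp only [Submodule.mul_iSup]
      refine iSup₂_le fun p hp => le_iSup₂_of_le (p.1 + 1, p.2) ?_ ?_
      · rw [Finset.HasAntidiagonal.mem_antidiagonal] at hp ⊢; simp only; omega
      · rw [← mul_assoc, symPow_succ]
    · refine (mul_le_mul' le_rfl ih).trans ?_
      simp only [Submodule.mul_iSup]
      refine iSup₂_le fun p hp => le_iSup₂_of_le (p.1, p.2 + 1) ?_ ?_
      · rw [Finset.HasAntidiagonal.mem_antidiagonal] at hp ⊢; simp only; omega
      · rw [mul_left_comm, symPow_succ]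

theorem exists_sum_of_mem_iSup {ι E : Type*} [AddCommGroup E] [Module k E] (s : Finset ι)
    (A : ι → Submodule k E) {x : E} (hx : x ∈ ⨆ p ∈ s, A p) :
    ∃ u : ι → E, (∀ p, u p ∈ A p) ∧ ∑ p ∈ s, u p = x := by
  obtain ⟨μ, hμ⟩ := (Submodule.mem_iSup_finset_iff_exists_sum A x).1 hx
  exact ⟨fun p => μ p, fun p => SetLike.coe_mem _, hμ⟩

/-- Left factors taken from a basis allow coefficients to be compared by linear independence. -/
theorem exists_sum_basis_mul {R : Type*} [CommRing R] [Algebra k R] {A B : Submodule k R}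
    {m : ℕ} (p : Basis (Fin m) k A) {x : R} (hx : x ∈ A * B) :
    ∃ q : Fin m → R, (∀ s, q s ∈ B) ∧ x = ∑ s, (p s : R) * q s := by
  induction hx using Submodule.mul_induction_on' with
  | mem_mul_mem a ha b hb =>
    refine ⟨fun s => p.repr ⟨a, ha⟩ s • b, fun s => Submodule.smul_mem _ _ hb, ?_⟩
    have := congrArg Subtype.val (p.sum_repr ⟨a, ha⟩)
    simp only [Submodule.coe_sum, Submodule.coe_smul] at this
    conv_lhs => rw [← this, Finset.sum_mul]
    simp
  | add x _ y _ hx hy =>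
    obtain ⟨q, hq, rfl⟩ := hx
    obtain ⟨q', hq', rfl⟩ := hy
    refine ⟨q + q', fun s => add_mem (hq s) (hq' s), ?_⟩
    simp [mul_add, Finset.sum_add_distrib]

end Backward

/-! ### From a balanced direct product to a balanced direct sum. -/

section Backward

open RingTheory.Sequence

variable {k V : Type*} [Field k] [AddCommGroup V] [Module k V]

theorem exists_polar_mem_symPow {W : Submodule k V} {Z : Submodule k (Dual k V)} {i j : ℕ}
    {g : SymmetricAlgebra k V} (hg : g ∈ symPow W i) {F : SymmetricAlgebra k (Dual k V)}
    (hF : F ∈ symPow Z j) : ∃ m, polar g F ∈ symPow Z m := by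
  rcases lt_or_ge j i with h | h
  · exact ⟨0, by rw [polar_eq_zero_of_lt hg hF h]; exact zero_mem _⟩
  · exact ⟨j - i, polar_mem_symPow hg (by rwa [Nat.add_sub_cancel' h])⟩

section Split

variable {W₁ W₂ : Submodule k V} (hW : IsCompl W₁ W₂) {Z₁ Z₂ : Submodule k (Dual k V)}
  (hZ₁ : ∀ φ ∈ Z₁, ∀ w ∈ W₂, φ w = 0) (hZ₂ : ∀ φ ∈ Z₂, ∀ w ∈ W₁, φ w = 0)
  {e₁ e₂ : ℕ} {F₁ F₂ : SymmetricAlgebra k (Dual k V)} (hF₁ : F₁ ∈ symPow Z₁ e₁)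
  (hF₂ : F₂ ∈ symPow Z₂ e₂)

include hZ₁ hZ₂ hF₁ hF₂ in
theorem polar_mul_mul {i j : ℕ} {p q : SymmetricAlgebra k V} (hp : p ∈ symPow W₁ i)
    (hq : q ∈ symPow W₂ j) : polar (p * q) (F₁ * F₂) = polar p F₁ * polar q F₂ := by
  obtain ⟨m, hm⟩ := exists_polar_mem_symPow hq hF₂
  rw [polar_mul_apply, polar_mul_left_of_vanishing hZ₁ hq hF₁,
    polar_mul_right_of_vanishing hZ₂ hp hm]

/-- The retraction of `Sym V^∨` onto `Sym Z₁`. -/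
def dualRetraction : SymmetricAlgebra k (Dual k V) →ₐ[k] SymmetricAlgebra k (Dual k V) :=
  symMap (W₁.projection W₂ hW).dualMap

include hZ₁ in
theorem dualRetraction_eq_self {m : ℕ} {F : SymmetricAlgebra k (Dual k V)}
    (hF : F ∈ symPow Z₁ m) : dualRetraction hW F = F := by
  refine symMap_eq_self (fun φ hφ => LinearMap.ext fun v => ?_) hF
  rw [LinearMap.dualMap_apply]
  have h := hZ₁ φ hφ _ (Submodule.sub_projection_mem hW v)
  rw [map_sub, sub_eq_zero] at h
  exact h.symm

include hZ₂ in
theorem dualRetraction_eq_zero {m : ℕ} (hm : m ≠ 0) {F : SymmetricAlgebra k (Dual k V)}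
    (hF : F ∈ symPow Z₂ m) : dualRetraction hW F = 0 := by
  refine symMap_eq_zero (fun φ hφ => LinearMap.ext fun v => ?_) hm hF
  rw [LinearMap.dualMap_apply]
  exact hZ₂ φ hφ _ (Submodule.projection_apply_mem hW v)

include hZ₁ hZ₂ hF₁ hF₂ in
-- On `x = p * q` the result is `(p ∘ F₁)(fq ∘ F₂)`, whose second factor is zero or of positive
-- degree in `Sym Z₂`, which the retraction kills.
theorem dualRetraction_polar_eq_zero {i j m : ℕ} (h : m + j ≠ e₂) {f x : SymmetricAlgebra k V}
    (hf : f ∈ symPow W₂ m) (hx : x ∈ symPow W₁ i * symPow W₂ j) :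
    dualRetraction hW (polar (f * x) (F₁ * F₂)) = 0 := by
  induction hx using Submodule.mul_induction_on' with
  | mem_mul_mem p hp q hq =>
    have hfq := mul_mem_symPow hf hq
    rw [mul_left_comm, polar_mul_mul hZ₁ hZ₂ hF₁ hF₂ hp hfq, map_mul]
    rcases lt_or_gt_of_ne h with hlt | hgt
    · obtain ⟨r, rfl⟩ := Nat.exists_eq_add_of_lt hlt
      rw [dualRetraction_eq_zero hW hZ₂ (Nat.succ_ne_zero r) (polar_mem_symPow hfq hF₂), mul_zero]
    · rw [polar_eq_zero_of_lt hfq hF₂ hgt, map_zero, mul_zero]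
  | add x _ y _ hx hy => rw [mul_add, map_add, LinearMap.add_apply, map_add, hx, hy, add_zero]

include hZ₁ hF₁ in
theorem dualRetraction_polar_left {i : ℕ} {p : SymmetricAlgebra k V} (hp : p ∈ symPow W₁ i) :
    dualRetraction hW (polar p F₁) = polar p F₁ := by
  obtain ⟨m, hm⟩ := exists_polar_mem_symPow hp hF₁
  exact dualRetraction_eq_self hW hZ₁ hm

include hW hZ₁ hZ₂ hF₁ hF₂ in
/-- The part of bidegree `(i, j)` of a polynomial that is apolar to `F₁ F₂` satisfies the
contracted equations. -/
theorem polar_sum_smul_eq_zero {d : ℕ} {u : ℕ × ℕ → SymmetricAlgebra k V}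
    (hu : ∀ p, u p ∈ symPow W₁ p.1 * symPow W₂ p.2)
    (hker : polar (∑ p ∈ Finset.HasAntidiagonal.antidiagonal d, u p) (F₁ * F₂) = 0)
    {i j m : ℕ} (hij : i + j = d) (hm : m + j = e₂) {s : ℕ} {p q : Fin s → SymmetricAlgebra k V}
    (hp : ∀ t, p t ∈ symPow W₁ i) (hq : ∀ t, q t ∈ symPow W₂ j) (hpq : u (i, j) = ∑ t, p t * q t)
    {f : SymmetricAlgebra k V} (hf : f ∈ symPow W₂ m) :
    polar (∑ t, polarFunctional F₂ (f * q t) • p t) F₁ = 0 := by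
  -- Multiplying by `f` of degree `e₂ - j` and retracting isolates one bidegree: every other second
  -- index differs from `j`.
  have h1 : dualRetraction hW (polar (f * u (i, j)) (F₁ * F₂)) = 0 := by
    have h2 : dualRetraction hW (polar (f * ∑ p ∈ Finset.HasAntidiagonal.antidiagonal d, u p)
        (F₁ * F₂)) = 0 := by
      rw [polar_mul_apply, hker, map_zero, map_zero]
    rw [Finset.mul_sum, map_sum, LinearMap.sum_apply, map_sum, Finset.sum_eq_single (i, j)] at h2
    · exact h2
    · rintro ⟨i', j'⟩ h hne
      rw [Finset.HasAntidiagonal.mem_antidiagonal] at h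
      simp only at h
      refine dualRetraction_polar_eq_zero hW hZ₁ hZ₂ hF₁ hF₂ (fun hj => hne ?_) hf (hu (i', j'))
      ext <;> simp only <;> omega
    · intro h
      exact absurd (Finset.HasAntidiagonal.mem_antidiagonal.2 hij) h
  rw [hpq, Finset.mul_sum, map_sum, LinearMap.sum_apply, map_sum] at h1
  rw [map_sum, LinearMap.sum_apply, ← h1]
  refine Finset.sum_congr rfl fun t _ => ?_
  have hfq : f * q t ∈ symPow W₂ e₂ := hm ▸ mul_mem_symPow hf (hq t)
  rw [mul_left_comm, polar_mul_mul hZ₁ hZ₂ hF₁ hF₂ (hp t) hfq, map_mul (dualRetraction hW),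
    dualRetraction_polar_left hW hZ₁ hF₁ (hp t), ← algebraMap_polarFunctional
      (symPow_mono le_top _ hF₂) (symPow_mono le_top _ hfq), AlgHom.commutes, map_smul,
    LinearMap.smul_apply, Algebra.smul_def, mul_comm]

end Split

variable [FiniteDimensional k V]

theorem isBalancedSumAlong_of_isBalancedProductAlong {n d : ℕ} (hV : finrank k V = n)
    (hd : d ≠ 0) {U : Submodule k (SymmetricAlgebra k V)} (hU : U ∈ grassRes k V n d)
    (hm : ∀ i, i ≠ 0 → i ≤ n * (d - 1) → (i : k) ≠ 0)
    {F : SymmetricAlgebra k (Dual k V)} (hF : IsAssociatedForm n d U F)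
    {W₁ W₂ : Submodule k V} (hW : IsCompl W₁ W₂) {Z₁ Z₂ : Submodule k (Dual k V)}
    (hZ₁ : ∀ φ ∈ Z₁, ∀ w ∈ W₂, φ w = 0) (hZ₂ : ∀ φ ∈ Z₂, ∀ w ∈ W₁, φ w = 0)
    (h : IsBalancedProductAlong Z₁ Z₂ F) : IsBalancedSumAlong d W₁ W₂ U := by
  obtain ⟨hF0, e₁, e₂, F₁, F₂, hF₁, hF₂, rfl, -⟩ := h
  have hUd := hU.1
  have hF₁0 : F₁ ≠ 0 := left_ne_zero_of_mul hF0
  have hF₂0 : F₂ ≠ 0 := right_ne_zero_of_mul hF0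
  have he : e₁ + e₂ = n * (d - 1) :=
    DirectSum.degree_eq_of_mem_mem (fun i => symPow (⊤ : Submodule k (Dual k V)) i)
      (mul_mem_symPow (symPow_mono le_top _ hF₁) (symPow_mono le_top _ hF₂)) hF.1 hF0
  have hm₂ : ∀ i, i ≠ 0 → i ≤ e₂ → (i : k) ≠ 0 := fun i h0 hi => hm i h0 (by omega)
  have hleft {i : ℕ} {p : SymmetricAlgebra k V} (hp : p ∈ symPow W₁ i) (h : polar p F₁ = 0) :
      p ∈ Ideal.span (U : Set (SymmetricAlgebra k V)) := by
    rw [hF.2, polar_mul_right_of_vanishing hZ₂ hp hF₂, h, zero_mul]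
  have hright {j : ℕ} {q : SymmetricAlgebra k V} (hq : q ∈ symPow W₂ j) (h : polar q F₂ = 0) :
      q ∈ Ideal.span (U : Set (SymmetricAlgebra k V)) := by
    rw [hF.2, polar_mul_left_of_vanishing hZ₁ hq hF₁, h, mul_zero]
  have hsplit : U ≤ U ⊓ symPow W₁ d ⊔ U ⊓ symPow W₂ d := by
    intro x hx
    have hx' : x ∈ symPow (W₁ ⊔ W₂) d := by rw [hW.sup_eq_top]; exact hUd hx
    obtain ⟨u, hu, rfl⟩ := exists_sum_of_mem_iSup _ _ (symPow_sup_le W₁ W₂ d hx')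
    have hker := (hF.2 _).1 (Ideal.subset_span hx)
    -- Contraction with each `f` gives an element of `I_U` of degree `i < d`, hence zero. Linear
    -- independence then makes `f * q t` annihilate `F₂` for all `f`, so `q t ∘ F₂ = 0`, and `q t`
    -- is an element of `I_U` of degree `j < d`, hence zero.
    have hmix : ∀ i j, i + j = d → i ≠ 0 → j ≠ 0 → u (i, j) = 0 := by
      intro i j hij hi hj
      obtain ⟨q, hq, hpq⟩ := exists_sum_basis_mul (finBasis k (symPow W₁ i)) (hu (i, j))
      have hp (t) : (finBasis k (symPow W₁ i) t : SymmetricAlgebra k V) ∈ symPow W₁ i :=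
        SetLike.coe_mem _
      have hq0 (t) : q t = 0 := by
        refine eq_zero_of_mem_ideal_span hUd (j := j) (by omega) (symPow_mono le_top _ (hq t))
          (hright (hq t) ?_)
        rcases lt_or_ge e₂ j with hlt | hge
        · exact polar_eq_zero_of_lt (hq t) hF₂ hlt
        · obtain ⟨m, rfl⟩ := Nat.exists_eq_add_of_le hge
          refine eq_zero_of_forall_polar_eq_zero_of_vanishing hW.sup_eq_top hZ₂ (m := m)
            (fun i h0 hi => hm₂ i h0 (by omega)) (polar_mem_symPow (hq t) hF₂) fun f hf => ?_
          have h1 := polar_sum_smul_eq_zero hW hZ₁ hZ₂ hF₁ hF₂ hu hker hij (add_comm m j) hp hq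
            hpq hf
          have hmem := Submodule.sum_mem (symPow W₁ i) (t := Finset.univ)
            fun t _ => Submodule.smul_mem _ (polarFunctional F₂ (f * q t)) (hp t)
          have h2 := eq_zero_of_mem_ideal_span hUd (j := i) (by omega) (symPow_mono le_top _ hmem)
            (hleft hmem h1)
          have hli := (finBasis k (symPow W₁ i)).linearIndependent.map' (symPow W₁ i).subtype
            (Submodule.ker_subtype _)
          have h3 := Fintype.linearIndependent_iff.1 hli _ h2 t
          have hfq : f * q t ∈ symPow W₂ (j + m) := by
            rw [add_comm]; exact mul_mem_symPow hf (hq t)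
          rw [← polar_mul_apply, ← algebraMap_polarFunctional (symPow_mono le_top _ hF₂)
            (symPow_mono le_top _ hfq), h3, map_zero]
      rw [hpq]
      exact Finset.sum_eq_zero fun t _ => by rw [hq0 t, mul_zero]
    have hsum : ∑ p ∈ Finset.HasAntidiagonal.antidiagonal d, u p = u (d, 0) + u (0, d) := by
      refine Finset.sum_eq_add_of_mem (d, 0) (0, d) (by simp) (by simp) (by simp [hd]) ?_
      rintro ⟨i, j⟩ hij ⟨h1, h2⟩
      rw [Finset.HasAntidiagonal.mem_antidiagonal] at hij
      simp only at hij
      refine hmix i j hij (fun h => h2 ?_) fun h => h1 ?_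
      · ext <;> simp only <;> omega
      · ext <;> simp only <;> omega
    have h₁ : u (d, 0) ∈ symPow W₁ d := by
      have := hu (d, 0)
      rwa [symPow_zero, mul_one] at this
    have h₂ : u (0, d) ∈ symPow W₂ d := by
      have := hu (0, d)
      rwa [symPow_zero, one_mul] at this
    have h₁U : u (d, 0) ∈ U := by
      refine mem_of_mem_ideal_span hUd (symPow_mono le_top _ h₁) (hleft h₁ ?_)
      -- Contraction with such an `f`, the decomposition being `u (d, 0) * 1`, gives a nonzero
      -- multiple of `u (d, 0) ∘ F₁`.
      obtain ⟨f, hf, hfF⟩ : ∃ f ∈ symPow W₂ e₂, polar f F₂ ≠ 0 := by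
        by_contra! hcon
        exact hF₂0 (eq_zero_of_forall_polar_eq_zero_of_vanishing hW.sup_eq_top hZ₂ hm₂ hF₂ hcon)
      have h1 := polar_sum_smul_eq_zero hW hZ₁ hZ₂ hF₁ hF₂ hu hker (add_zero d) (add_zero e₂)
        (s := 1) (p := fun _ => u (d, 0)) (q := fun _ => 1) (fun _ => h₁)
        (fun _ => by rw [symPow_zero]; exact Submodule.one_le.1 le_rfl) (by simp) hf
      rw [Fin.sum_univ_one, mul_one, map_smul, LinearMap.smul_apply] at h1
      refine (smul_eq_zero.1 h1).resolve_left fun h0 => hfF ?_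
      rw [← algebraMap_polarFunctional (symPow_mono le_top _ hF₂) (symPow_mono le_top _ hf), h0,
        map_zero]
    rw [hsum] at hx ⊢
    have h₂U : u (0, d) ∈ U := by
      have := sub_mem hx h₁U
      rwa [add_sub_cancel_left] at this
    exact Submodule.add_mem_sup ⟨h₁U, h₁⟩ ⟨h₂U, h₂⟩
  have hUeq : U = U ⊓ symPow W₁ d ⊔ U ⊓ symPow W₂ d :=
    le_antisymm hsplit (sup_le inf_le_left inf_le_left)
  have hdisj : (U ⊓ symPow W₁ d) ⊓ (U ⊓ symPow W₂ d) = ⊥ := by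
    rw [eq_bot_iff]
    rintro x ⟨⟨-, h₁⟩, -, h₂⟩
    rw [Submodule.mem_bot, ← symMap_eq_self (T := W₁.projection W₂ hW)
      (fun v hv => Submodule.projection_apply_of_mem_left hW hv) h₁]
    exact symMap_eq_zero (fun v hv => (Submodule.projection_apply_eq_zero_iff hW).2 hv) hd h₂
  have : FiniteDimensional k U := Submodule.finiteDimensional_of_le hUd
  have hdim : finrank k ↥(U ⊓ symPow W₁ d) + finrank k ↥(U ⊓ symPow W₂ d) = n := by
    rw [← Submodule.finrank_sup_add_finrank_inf_eq, hdisj, ← hUeq, hU.2.1, finrank_bot, add_zero]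
  have hI : ∀ j, n * (d - 1) < j → ∀ f ∈ symPow (⊤ : Submodule k V) j,
      f ∈ Ideal.span (U : Set (SymmetricAlgebra k V)) :=
    fun j hj f hf => (hF.2 f).2 (polar_eq_zero_of_lt hf hF.1 hj)
  -- Retracted to `Sym W`, the ideal still contains all forms of degree above `n * (d - 1)`, so at
  -- least `dim W` equations are needed. The two bounds add up to `n`, which forces equality in
  -- both.
  have bound {W W' : Submodule k V} (hW : IsCompl W W')
      (hUeq : U = U ⊓ symPow W d ⊔ U ⊓ symPow W' d)
      (hdim : finrank k ↥(U ⊓ symPow W d) + finrank k ↥(U ⊓ symPow W' d) = n) :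
      finrank k W ≤ finrank k ↥(U ⊓ symPow W d) := by
    obtain ⟨rs, hlen, hrs, hreg, hker⟩ :=
      exists_isWeaklyRegular_retract hd hU hW inf_le_right inf_le_right hUeq hdim
    rw [← hlen]
    refine finrank_le_length hd hrs hreg (N := n * (d - 1)) fun j hj f hf => ?_
    have := hker (symMap W.subtype f) (hI j hj _ (symMap_mem_symPow _ le_top hf))
    rwa [symMap_symMap, Submodule.projectionOnto_comp_subtype, symMap_id] at this
  have b₁ := bound hW hUeq hdim
  have b₂ := bound hW.symm (hUeq.trans (sup_comm _ _)) (by omega)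
  have hn : finrank k W₁ + finrank k W₂ = n := by
    rw [Submodule.finrank_add_eq_of_isCompl hW, hV]
  exact ⟨_, _, inf_le_right, inf_le_right, by omega, by omega, hUeq⟩

end Backward

/-! ### Characteristic, annihilators and dual bases. -/

section Final

variable {k V : Type*} [Field k] [AddCommGroup V] [Module k V]

theorem natCast_ne_zero_of_ringChar {N : ℕ} (h : ringChar k = 0 ∨ N < ringChar k) (i : ℕ)
    (h0 : i ≠ 0) (hi : i ≤ N) : (i : k) ≠ 0 := by
  rw [Ne, ringChar.spec]
  rcases h with h | h
  · rw [h, zero_dvd_iff]; exact h0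
  · intro hdvd
    have := Nat.le_of_dvd (Nat.pos_of_ne_zero h0) hdvd
    omega

theorem exists_isAssociatedForm [FiniteDimensional k V] {n d : ℕ} (hV : finrank k V = n)
    (hd : d ≠ 0) {U : Submodule k (SymmetricAlgebra k V)} (hU : U ∈ grassRes k V n d)
    (hm : ∀ i, i ≠ 0 → i ≤ n * (d - 1) → (i : k) ≠ 0) : ∃ F, IsAssociatedForm n d U F := by
  obtain ⟨rs, hlen, hrs, hreg, hrsU⟩ := exists_list_of_mem_grassRes hU
  subst hV
  obtain ⟨F, hF, hFrs⟩ := exists_polar_eq_zero_iff hd hlen hrs hreg hm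
  exact ⟨F, hF, by rwa [hrsU] at hFrs⟩

/-- If `F` were zero, `1` would lie in `I_U`, but a regular sequence generates a proper ideal. -/
theorem IsAssociatedForm.ne_zero {n d : ℕ} {U : Submodule k (SymmetricAlgebra k V)}
    (hU : U ∈ grassRes k V n d) {F : SymmetricAlgebra k (Dual k V)}
    (hF : IsAssociatedForm n d U F) : F ≠ 0 := by
  rintro rfl
  obtain ⟨-, -, g, rfl, hreg⟩ := hU
  refine hreg.top_ne_smul (Eq.symm ?_)
  rw [smul_eq_mul, Ideal.mul_top, Ideal.eq_top_iff_one]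
  have h := (hF.2 1).2 (map_zero _)
  rw [ideal_span_submodule_span] at h
  convert h using 2
  ext; simp [List.mem_ofFn]

theorem eq_bot_of_dualAnnihilator_eq_bot {W₁ W₂ : Submodule k V} (h : IsCompl W₁ W₂)
    (h₂ : W₂.dualAnnihilator = ⊥) : W₁ = ⊥ := by
  rw [← Submodule.dualAnnihilator_top, Subspace.dualAnnihilator_inj] at h₂
  rw [← h.inf_eq_bot, h₂, inf_top_eq]

theorem eq_bot_of_dualCoannihilator_eq_bot [FiniteDimensional k V] {Z₁ Z₂ : Submodule k (Dual k V)}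
    (h : IsCompl Z₁ Z₂) (h₁ : Z₁.dualCoannihilator = ⊥) : Z₂ = ⊥ := by
  have : Z₁ = ⊤ := by
    rw [← Subspace.dualCoannihilator_dualAnnihilator_eq (W := Z₁), h₁,
      Submodule.dualAnnihilator_bot]
  rw [← h.inf_eq_bot, this, top_inf_eq]

theorem isCompl_dualCoannihilator [FiniteDimensional k V] {Z₁ Z₂ : Submodule k (Dual k V)}
    (h : IsCompl Z₁ Z₂) : IsCompl Z₂.dualCoannihilator Z₁.dualCoannihilator :=
  (Subspace.orderIsoFiniteDimensional (K := k) (V := V)).symm.isCompl h.symm.dual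

theorem isCompl_span_image {n : ℕ} (b : Basis (Fin n) k V) (a : ℕ) :
    IsCompl (headSpan b a) (tailSpan b a) := by
  have hd : Disjoint {i : Fin n | (i : ℕ) < a} {i | a ≤ (i : ℕ)} :=
    Set.disjoint_left.2 fun i (h : (i : ℕ) < a) (h' : a ≤ (i : ℕ)) => not_lt.2 h' h
  refine ⟨b.linearIndependent.disjoint_span_image hd, ?_⟩
  rw [codisjoint_iff, headSpan, tailSpan, ← Submodule.span_union, ← Set.image_union]
  have : {i : Fin n | (i : ℕ) < a} ∪ {i | a ≤ (i : ℕ)} = Set.univ := by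
    ext i; simpa using lt_or_ge (i : ℕ) a
  rw [this, Set.image_univ, b.span_eq]

theorem apply_eq_zero_of_mem_span {ι : Type*} {z : ι → Dual k V} {x : ι → V} {s t : Set ι}
    (h : ∀ i ∈ s, ∀ j ∈ t, z i (x j) = 0) :
    ∀ φ ∈ Submodule.span k (z '' s), ∀ w ∈ Submodule.span k (x '' t), φ w = 0 := by
  intro φ hφ w hw
  induction hφ using Submodule.span_induction with
  | mem φ hφ =>
    obtain ⟨i, hi, rfl⟩ := hφ
    induction hw using Submodule.span_induction with
    | mem w hw => obtain ⟨j, hj, rfl⟩ := hw; exact h i hi j hj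
    | zero => exact map_zero _
    | add w w' _ _ ih ih' => rw [map_add, ih, ih', add_zero]
    | smul c w _ ih => rw [map_smul, ih, smul_zero]
  | zero => rfl
  | add φ ψ _ _ ih ih' => rw [LinearMap.add_apply, ih, ih', add_zero]
  | smul c φ _ ih => rw [LinearMap.smul_apply, ih, smul_zero]

end Final

end

end AssocForm

theorem proposition4p2 {k : Type*} [Field k] {V : Type*} [AddCommGroup V] [Module k V]
    [FiniteDimensional k V] (n d : ℕ) (hn : 2 ≤ n) (hV : Module.finrank k V = n) (hd : 2 ≤ d)
    (hchar : ringChar k = 0 ∨ n * (d - 1) < ringChar k)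
    (U : Submodule k (SymmetricAlgebra k V)) (hU : U ∈ AssocForm.grassRes k V n d) :
    -- the associated form of `U` exists and is unique up to a nonzero scalar
    (∃ F, AssocForm.IsAssociatedForm n d U F ∧
      ∀ G, AssocForm.IsAssociatedForm n d U G → ∃ c : k, c ≠ 0 ∧ G = c • F) ∧
    ∀ F, AssocForm.IsAssociatedForm n d U F →
      (AssocForm.IsBalancedDirectSum d U ↔ AssocForm.IsBalancedDirectProduct F) ∧
      -- `z` is a basis of the dual space of `V`, `x` is the dual basis of `V`
      ∀ (z : Module.Basis (Fin n) k (Module.Dual k V)) (x : Module.Basis (Fin n) k V),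
        (∀ i j, z i (x j) = if i = j then 1 else 0) →
        ∀ a : ℕ, 1 ≤ a → a ≤ n - 1 →
          AssocForm.IsBalancedProductAlong
            (AssocForm.headSpan z a) (AssocForm.tailSpan z a) F →
          AssocForm.IsBalancedSumAlong d
            (AssocForm.headSpan x a) (AssocForm.tailSpan x a) U := by
  have hd0 : d ≠ 0 := by omega
  have hm := AssocForm.natCast_ne_zero_of_ringChar hchar
  refine ⟨?_, fun F hF => ⟨⟨?_, ?_⟩, ?_⟩⟩
  · obtain ⟨F, hF⟩ := AssocForm.exists_isAssociatedForm hV hd0 hU hm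
    refine ⟨F, hF, fun G hG => ?_⟩
    obtain ⟨c, hc⟩ := AssocForm.exists_smul_eq_of_polar_eq_zero hm hF.1 hG.1
      fun g _ hg => (hG.2 g).1 ((hF.2 g).2 hg)
    refine ⟨c, ?_, hc⟩
    rintro rfl
    exact hG.ne_zero hU (by rw [hc, zero_smul])
  · rintro ⟨W₁, W₂, hW, hW₁, hW₂, h⟩
    -- The indices cross over: the annihilator of `W₂` is the copy of the dual of `W₁` in `V^∨`.
    refine ⟨W₂.dualAnnihilator, W₁.dualAnnihilator, ?_, ?_, ?_,
      AssocForm.isBalancedProductAlong_of_isBalancedSumAlong hV hd0 hU hm hF hW h⟩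
    · exact Subspace.isCompl_dualAnnihilator hW.symm
    · exact fun h0 => hW₁ (AssocForm.eq_bot_of_dualAnnihilator_eq_bot hW h0)
    · exact fun h0 => hW₂ (AssocForm.eq_bot_of_dualAnnihilator_eq_bot hW.symm h0)
  · rintro ⟨Z₁, Z₂, hZ, hZ₁, hZ₂, h⟩
    refine ⟨Z₂.dualCoannihilator, Z₁.dualCoannihilator, AssocForm.isCompl_dualCoannihilator hZ,
      ?_, ?_, AssocForm.isBalancedSumAlong_of_isBalancedProductAlong hV hd0 hU hm hF
        (AssocForm.isCompl_dualCoannihilator hZ)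
        (fun φ hφ w hw => (Submodule.mem_dualCoannihilator w).1 hw φ hφ)
        (fun φ hφ w hw => (Submodule.mem_dualCoannihilator w).1 hw φ hφ) h⟩
    · exact fun h0 => hZ₁ (AssocForm.eq_bot_of_dualCoannihilator_eq_bot hZ.symm h0)
    · exact fun h0 => hZ₂ (AssocForm.eq_bot_of_dualCoannihilator_eq_bot hZ h0)
  · intro z x hzx a _ _ h
    refine AssocForm.isBalancedSumAlong_of_isBalancedProductAlong hV hd0 hU hm hF
      (AssocForm.isCompl_span_image x a) (AssocForm.apply_eq_zero_of_mem_span ?_)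
      (AssocForm.apply_eq_zero_of_mem_span ?_) h
    · intro i (hi : (i : ℕ) < a) j (hj : a ≤ (j : ℕ))
      rw [hzx, if_neg]
      rintro rfl; omega
    · intro i (hi : a ≤ (i : ℕ)) j (hj : (j : ℕ) < a)
      rw [hzx, if_neg]
      rintro rfl; omega
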